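/- Let $\Sigma\subset\mathbb R^2$ be open and let $f\colon\Sigma\to\mathbb R^3$ be a $C^\infty$ front with Gauss map $\nu\colon\Sigma\to\mathbb S^2$, i.e. $\nu$ is $C^\infty$, $\langle df(X),\nu\rangle=0$ for all tangent vectors $X$, and $(f,\nu)$ is an immersion. For a map $g$ with unit normal field $n$, put $\lambda^g=\det(g_u,g_v,n)$, $I(X,Y)=\langle dg(X),dg(Y)\rangle$ and $II(X,Y)=-\langle dg(X),dn(Y)\rangle$. A singular point $p$ of $g$ (a point where $g$ is not an immersion) is *non-degenerate* if $d\lambda^g(p)\neq0$. It is *of the second kind* if, moreover, the regular curve $\gamma$ through $\gamma(0)=p$ in the singular set and a nowhere vanishing null vector field $\eta$ (so that $dg(\eta)=0$ on the singular set) satisfy: $\gamma'(0)$ and $\eta(p)$ are linearly dependent. Let $p$ be a singular point of the second kind of $f$, and write $\lambda=\lambda^f$. Let $K$ and $H$ be the Gaussian and mean curvatures of $f$ on the set of regular points. Near $p$, one of the two principal curvatures $H\pm\operatorname{sgn}(\lambda)\sqrt{H^2-K}$ is bounded and extends to a $C^\infty$ function $\kappa$. The other one, $\tilde\kappa$, is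 unbounded, and $\lambda\tilde\kappa$ extends to a $C^\infty$ function $\hat\kappa$ with $\hat\kappa(p)\ne0$. Let $\hat\rho=\lambda/\hat\kappa$ and let $\widehat C=f+\hat\rho\,\nu$ be the focal surface associated to the unbounded principal curvature. The point $p$ is *sub-parabolic* if $(\widetilde V\kappa)(p)=0$, where $\widetilde V$ is a nowhere vanishing $C^\infty$ vector field near $p$ which at regular points is a principal vector for $\tilde\kappa$, i.e. $II(X,\widetilde V)=\tilde\kappa\, I(X,\widetilde V)$ for all $X$. A function defined off the singular set is *rationally bounded* at $p$ if near $p$ it is a quotient $A/B$, with $B\neq0$ off the singular set, of $C^\infty$ functions such that, for some integer $m\ge0$, $B$ has a zero of order exactly $m$ at $p$ and $A$ has a zero of order at least $m$ at $p$. The *limiting normal curvature* at a singular point $p$ with $\operatorname{rank}dg_p=1$ is $II(w,w)/I(w,w)$ at $p$, for any $w$ with $dg_p(w)\neq0$ (it does not depend on $w$). Then $\widehat C$ is a $C^\infty$ frontal near $p$, i.e. it has a $C^\infty$ unit normal field there. Suppose that $\widehat C$ has a non-degenerate singularity at $p$. Then the Gaussian curvature $K^{\widehat C}$ of $\widehat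 C$ is rationally bounded at $p$ if and only if $p$ is a sub-parabolic point of $f$. Moreover, in this case, and only in this case, the limiting normal curvature of $\widehat C$ vanishes at $p$. -/

import Mathlib

open Set Filter Topology
open scoped ContDiff RealInnerProductSpace

/-- Euclidean three-space. -/
abbrev E3 : Type := EuclideanSpace ℝ (Fin 3)

noncomputable section

/-- The determinant of the `3 × 3` matrix with rows `a`, `b`, `c`. -/
def det3 (a b c : E3) : ℝ :=
  Matrix.det (Matrix.of ![a.ofLp, b.ofLp, c.ofLp])

/-- The partial derivative `g_u`, for a map of the `(u,v)`-plane. -/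
def pdU {F : Type*} [NormedAddCommGroup F] [NormedSpace ℝ F] (g : ℝ × ℝ → F) (q : ℝ × ℝ) : F :=
  fderiv ℝ g q (1, 0)

/-- The partial derivative `g_v`. -/
def pdV {F : Type*} [NormedAddCommGroup F] [NormedSpace ℝ F] (g : ℝ × ℝ → F) (q : ℝ × ℝ) : F :=
  fderiv ℝ g q (0, 1)

/-! ### Frontals, fronts and their singular points -/

/-- `g` is a `C^∞` frontal on the open set `S` with Gauss map (smooth unit normal field) `n`. -/
structure IsFrontal (S : Set (ℝ × ℝ)) (g n : ℝ × ℝ → E3) : Prop where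
  smooth : ContDiffOn ℝ ∞ g S
  smooth_normal : ContDiffOn ℝ ∞ n S
  norm_eq_one : ∀ q ∈ S, ‖n q‖ = 1
  orthogonal : ∀ q ∈ S, ∀ X : ℝ × ℝ, ⟪fderiv ℝ g q X, n q⟫ = 0

/-- `g` is a front on `S` with Gauss map `n`: a frontal for which `(g, n)` is an immersion. -/
structure IsFront (S : Set (ℝ × ℝ)) (g n : ℝ × ℝ → E3) : Prop extends IsFrontal S g n where
  immersion : ∀ q ∈ S, ∀ X : ℝ × ℝ, fderiv ℝ g q X = 0 → fderiv ℝ n q X = 0 → X = 0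

/-- The set of regular points of `g` in `S`, at which `g` is an immersion. -/
def regularSet (S : Set (ℝ × ℝ)) (g : ℝ × ℝ → E3) : Set (ℝ × ℝ) :=
  {q ∈ S | Function.Injective (fderiv ℝ g q)}

/-- The set `S(g)` of singular points of `g` in `S`. -/
def singularSet (S : Set (ℝ × ℝ)) (g : ℝ × ℝ → E3) : Set (ℝ × ℝ) :=
  {q ∈ S | ¬ Function.Injective (fderiv ℝ g q)}

/-- The signed area density function `λ = det(g_u, g_v, n)`. -/
def areaDensity (g n : ℝ × ℝ → E3) (q : ℝ × ℝ) : ℝ :=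
  det3 (pdU g q) (pdV g q) (n q)

/-- `p` is a non-degenerate singular point of the frontal `g` with Gauss map `n`. -/
def IsNondegenerateSingular (S : Set (ℝ × ℝ)) (g n : ℝ × ℝ → E3) (p : ℝ × ℝ) : Prop :=
  p ∈ singularSet S g ∧ (pdU (areaDensity g n) p, pdV (areaDensity g n) p) ≠ (0, 0)

/-- `γ : (-ε, ε) → S` is a singular curve through `p`: a regular `C^∞` curve with `γ 0 = p` along
which `λ` vanishes. -/
structure IsSingularCurve (S : Set (ℝ × ℝ)) (g n : ℝ × ℝ → E3) (p : ℝ × ℝ)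
    (ε : ℝ) (γ : ℝ → ℝ × ℝ) : Prop where
  pos : 0 < ε
  smooth : ContDiffOn ℝ ∞ γ (Ioo (-ε) ε)
  regular : ∀ t ∈ Ioo (-ε) ε, deriv γ t ≠ 0
  base : γ 0 = p
  mem : ∀ t ∈ Ioo (-ε) ε, γ t ∈ S
  vanish : ∀ t ∈ Ioo (-ε) ε, areaDensity g n (γ t) = 0

/-- `η` is a null vector field of `g` on the open neighbourhood `U ⊆ S` of `p`. -/
structure IsNullVectorField (S : Set (ℝ × ℝ)) (g : ℝ × ℝ → E3) (p : ℝ × ℝ)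
    (U : Set (ℝ × ℝ)) (η : ℝ × ℝ → ℝ × ℝ) : Prop where
  isOpen : IsOpen U
  mem : p ∈ U
  subset : U ⊆ S
  smooth : ContDiffOn ℝ ∞ η U
  ne_zero : ∀ q ∈ U, η q ≠ 0
  null : ∀ q ∈ singularSet S g ∩ U, fderiv ℝ g q (η q) = 0

/-- `p` is a singular point of the second kind: it is non-degenerate, and the velocity of the
singular curve and the null vector field are linearly dependent at `p`. (Singular curves and null
vector fields exist at every non-degenerate singular point, and their directions at `p` are
unique.) -/
def IsSecondKind (S : Set (ℝ × ℝ)) (g n : ℝ × ℝ → E3) (p : ℝ × ℝ) : Prop :=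
  IsNondegenerateSingular S g n p ∧
    ∃ (ε : ℝ) (γ : ℝ → ℝ × ℝ) (U : Set (ℝ × ℝ)) (η : ℝ × ℝ → ℝ × ℝ),
      IsSingularCurve S g n p ε γ ∧ IsNullVectorField S g p U η ∧
        ¬ LinearIndependent ℝ ![deriv γ 0, η p]

/-! ### Fundamental forms and curvatures -/

/-- The first fundamental form `I(X, Y) = ⟨dg(X), dg(Y)⟩` at `q`. -/
def firstForm (g : ℝ × ℝ → E3) (q X Y : ℝ × ℝ) : ℝ :=
  ⟪fderiv ℝ g q X, fderiv ℝ g q Y⟫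

/-- The second fundamental form `II(X, Y) = -⟨dg(X), dn(Y)⟩` at `q`. -/
def secondForm (g n : ℝ × ℝ → E3) (q X Y : ℝ × ℝ) : ℝ :=
  -⟪fderiv ℝ g q X, fderiv ℝ n q Y⟫

/-- The Gaussian curvature `(LN - M²) / (EG - F²)`, meaningful at regular points. -/
def gaussianCurvature (g n : ℝ × ℝ → E3) (q : ℝ × ℝ) : ℝ :=
  (secondForm g n q (1, 0) (1, 0) * secondForm g n q (0, 1) (0, 1)
      - secondForm g n q (1, 0) (0, 1) ^ 2) /
    (firstForm g q (1, 0) (1, 0) * firstForm g q (0, 1) (0, 1)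
      - firstForm g q (1, 0) (0, 1) ^ 2)

/-- The mean curvature `(EN - 2FM + GL) / (2(EG - F²))`, meaningful at regular points. -/
def meanCurvature (g n : ℝ × ℝ → E3) (q : ℝ × ℝ) : ℝ :=
  (firstForm g q (1, 0) (1, 0) * secondForm g n q (0, 1) (0, 1)
      - 2 * firstForm g q (1, 0) (0, 1) * secondForm g n q (1, 0) (0, 1)
      + firstForm g q (0, 1) (0, 1) * secondForm g n q (1, 0) (1, 0)) /
    (2 * (firstForm g q (1, 0) (1, 0) * firstForm g q (0, 1) (0, 1)
      - firstForm g q (1, 0) (0, 1) ^ 2))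

/-- The principal curvature `κ₁ = H + sgn(λ) √(H² - K)` on the set of regular points. The sign of
`λ` makes it continuous, up to the factor `λ`, across the singular curve: in adapted coordinates
`λ` has the sign of `v`, and the formula reads
`κ₁ = (k₁ + k₂) / (2v(EG - F²))` with smooth `k₁`, `k₂`, where `k₂ ≥ 0`. -/
def principalCurvature₁ (g n : ℝ × ℝ → E3) (q : ℝ × ℝ) : ℝ :=
  meanCurvature g n q
    + Real.sign (areaDensity g n q) * √(meanCurvature g n q ^ 2 - gaussianCurvature g n q)

/-- The other principal curvature, `κ₂ = H - sgn(λ) √(H² - K)`. -/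
def principalCurvature₂ (g n : ℝ × ℝ → E3) (q : ℝ × ℝ) : ℝ :=
  meanCurvature g n q
    - Real.sign (areaDensity g n q) * √(meanCurvature g n q ^ 2 - gaussianCurvature g n q)

/-- A function `φ` on `D` is bounded near `p`. -/
def IsBoundedNear (D : Set (ℝ × ℝ)) (φ : ℝ × ℝ → ℝ) (p : ℝ × ℝ) : Prop :=
  ∃ W ∈ 𝓝 p, ∃ c : ℝ, ∀ q ∈ W ∩ D, |φ q| ≤ c

open Classical in
/-- The bounded one, `κ`, of the principal curvatures near `p`, on the set of regular points. -/
def boundedPrincipalAux (S : Set (ℝ × ℝ)) (g n : ℝ × ℝ → E3) (p : ℝ × ℝ) : ℝ × ℝ → ℝ :=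
  if IsBoundedNear (regularSet S g) (principalCurvature₁ g n) p
  then principalCurvature₁ g n else principalCurvature₂ g n

open Classical in
/-- The other one, `κ̃`: the unbounded principal curvature near `p`, on the set of regular
points. -/
def unboundedPrincipal (S : Set (ℝ × ℝ)) (g n : ℝ × ℝ → E3) (p : ℝ × ℝ) : ℝ × ℝ → ℝ :=
  if IsBoundedNear (regularSet S g) (principalCurvature₁ g n) p
  then principalCurvature₂ g n else principalCurvature₁ g n

/-- The bounded principal curvature `κ`, extended by continuity from the set of regular points to
the singular points near `p`. -/
def boundedPrincipal (S : Set (ℝ × ℝ)) (g n : ℝ × ℝ → E3) (p : ℝ × ℝ) : ℝ × ℝ → ℝ :=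
  extendFrom (regularSet S g) (boundedPrincipalAux S g n p)

/-- The function `κ̂ = λ κ̃`, extended by continuity from the set of regular points to the singular
points near `p`. -/
def kappaHat (S : Set (ℝ × ℝ)) (g n : ℝ × ℝ → E3) (p : ℝ × ℝ) : ℝ × ℝ → ℝ :=
  extendFrom (regularSet S g) (fun q => areaDensity g n q * unboundedPrincipal S g n p q)

/-- The curvature radius function `ρ̂ = λ / κ̂` of the unbounded principal curvature. -/
def rhoHat (S : Set (ℝ × ℝ)) (g n : ℝ × ℝ → E3) (p : ℝ × ℝ) (q : ℝ × ℝ) : ℝ :=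
  areaDensity g n q / kappaHat S g n p q

/-- The focal surface `Ĉ = g + ρ̂ n` associated to the unbounded principal curvature near `p`. -/
def focalSurface (S : Set (ℝ × ℝ)) (g n : ℝ × ℝ → E3) (p : ℝ × ℝ) (q : ℝ × ℝ) : E3 :=
  g q + rhoHat S g n p q • n q

/-- `V` is a (smooth, nowhere vanishing) principal vector field on the open set `U` with respect to
the principal curvature `k`: `(II - k I) V = 0` at the regular points. -/
structure IsPrincipalVectorField (S : Set (ℝ × ℝ)) (g n : ℝ × ℝ → E3) (k : ℝ × ℝ → ℝ)
    (U : Set (ℝ × ℝ)) (V : ℝ × ℝ → ℝ × ℝ) : Prop where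
  smooth : ContDiffOn ℝ ∞ V U
  ne_zero : ∀ q ∈ U, V q ≠ 0
  principal : ∀ q ∈ regularSet S g ∩ U, ∀ X : ℝ × ℝ,
    secondForm g n q X (V q) - k q * firstForm g q X (V q) = 0

/-- `p` is a sub-parabolic point with respect to `κ`: the derivative `Ṽκ` of the bounded principal
curvature `κ` in the direction of a principal vector `Ṽ` of the unbounded principal curvature
vanishes at `p`. -/
def IsSubparabolic (S : Set (ℝ × ℝ)) (g n : ℝ × ℝ → E3) (p : ℝ × ℝ) : Prop :=
  ∃ (U : Set (ℝ × ℝ)) (V : ℝ × ℝ → ℝ × ℝ), IsOpen U ∧ p ∈ U ∧ U ⊆ S ∧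
    IsPrincipalVectorField S g n (unboundedPrincipal S g n p) U V ∧
    fderiv ℝ (boundedPrincipal S g n p) p (V p) = 0

/-- The function `φ`, defined on `D`, is rationally bounded at `p`: near `p` it is a quotient
`A / B` of `C^∞` functions, where for some `m` the function `B` has a zero of order exactly `m` at
`p` and `A` has a zero of order at least `m` at `p`. (So along each ray from `p` that is not a zero
direction of the `m`-th order part of `B`, it has a finite limit, which is a rational function of
the direction.) -/
def RationallyBoundedAt (D : Set (ℝ × ℝ)) (φ : ℝ × ℝ → ℝ) (p : ℝ × ℝ) : Prop :=
  ∃ (m : ℕ) (W : Set (ℝ × ℝ)) (A B : ℝ × ℝ → ℝ), IsOpen W ∧ p ∈ W ∧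
    ContDiffOn ℝ ∞ A W ∧ ContDiffOn ℝ ∞ B W ∧
    (∀ k < m, iteratedFDeriv ℝ k A p = 0) ∧
    (∀ k < m, iteratedFDeriv ℝ k B p = 0) ∧ iteratedFDeriv ℝ m B p ≠ 0 ∧
    ∀ q ∈ W ∩ D, B q ≠ 0 ∧ φ q = A q / B q

/-- The limiting normal curvature of the frontal `g` with Gauss map `n` at the corank one singular
point `p` is `k`: it is the normal curvature `II(w, w) / I(w, w)` at `p` in the directions `w` that
are not null. (It does not depend on `w`, because a null vector lies in the kernel of both forms; by
continuity it is the limit of the normal curvatures along the singular curve, where that is not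
null.) -/
def HasLimitingNormalCurvature (g n : ℝ × ℝ → E3) (p : ℝ × ℝ) (k : ℝ) : Prop :=
  (∃ w : ℝ × ℝ, fderiv ℝ g p w ≠ 0) ∧
    ∀ w : ℝ × ℝ, fderiv ℝ g p w ≠ 0 → secondForm g n p w w / firstForm g p w w = k

end

/-! ### Vector algebra in three-space -/

/-! Write `λ = det(f_u, f_v, ν)`, `μ = det(ν_u, ν_v, ν)` and `τ = 2Hλ` (`mixedDensity`). The
principal curvatures solve `λx² - τx + μ = 0`. Since `f` is a front of rank one at `p`, `τ(p) ≠ 0`,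
so `k² - τk + λμ = 0` has a smooth root `k` with `k(p) = τ(p)`. Then `κ̃ = k/λ`, `κ = μ/k` and `ρ =
λ/k` (`IsFrontal.exists_principalCurvatures`).

The map `df + ρ dν` is degenerate everywhere and has a smooth kernel field `V`, principal for `κ̃`.
Symmetry of the second fundamental form makes `dν(V)` normal to `C = f + ρν`; at `p` it is nonzero
by the front condition. So `C` is a frontal, and at a non-degenerate singularity every unit normal
`n` of `C` is parallel to `dν(V)`. At a point of the second kind `dλ(V) = 0`, hence `dρ(V) = 0` and
`dC(V) = 0` at `p`.

The map `dν + κ df` takes values in the line of `n`. Differentiating this and using equality of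
mixed derivatives, as for the Codazzi equation, gives at `p` the identity `(Vκ) |df(w)|² = ⟨dν(V),
n⟩ II(w, w)`, with `II` that of `C` (`IsFrontal.secondForm_focal`). So sub-parabolicity is the
vanishing of the limiting normal curvature of `C`.

Finally, the Gaussian curvature of `C` is `det(n_u, n_v, n) / det(C_u, C_v, n)`, with denominator
vanishing to order exactly one at `p`. It is rationally bounded iff the numerator vanishes there
(`rationallyBoundedAt_iff`), and at `p` the numerator is a nonzero multiple of `II(w, w)` for
non-null `w` (`IsFrontal.areaDensity_normal_focal`). -/

theorem det3_eq (a b c : E3) : det3 a b c =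
    a 0 * (b 1 * c 2 - b 2 * c 1) + a 1 * (b 2 * c 0 - b 0 * c 2)
      + a 2 * (b 0 * c 1 - b 1 * c 0) := by
  simp [det3, Matrix.det_fin_three]
  ring

theorem inner_eq_sum (a b : E3) : ⟪a, b⟫ = a 0 * b 0 + a 1 * b 1 + a 2 * b 2 := by
  simp [PiLp.inner_apply, Fin.sum_univ_three]
  ring

/-- The Gram determinant of two frames that share a unit normal vector. -/
theorem det3_mul_det3 {x y z t n : E3} (hn : ‖n‖ = 1) (hx : ⟪x, n⟫ = 0) (hy : ⟪y, n⟫ = 0) :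
    det3 x y n * det3 z t n = ⟪x, z⟫ * ⟪y, t⟫ - ⟪x, t⟫ * ⟪y, z⟫ := by
  have hnn : ⟪n, n⟫ = 1 := by rw [real_inner_self_eq_norm_sq, hn]; norm_num
  have key : det3 x y n * det3 z t n =
      ⟪x, z⟫ * (⟪y, t⟫ * ⟪n, n⟫ - ⟪y, n⟫ * ⟪n, t⟫) - ⟪x, t⟫ * (⟪y, z⟫ * ⟪n, n⟫ - ⟪y, n⟫ * ⟪n, z⟫)
        + ⟪x, n⟫ * (⟪y, z⟫ * ⟪n, t⟫ - ⟪y, t⟫ * ⟪n, z⟫) := by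
    simp only [det3_eq, inner_eq_sum]
    ring
  rw [key, hnn, hx, hy]
  ring

theorem clm_prod_apply {F : Type*} [NormedAddCommGroup F] [NormedSpace ℝ F]
    (A : ℝ × ℝ →L[ℝ] F) (Z : ℝ × ℝ) : A Z = Z.1 • A (1, 0) + Z.2 • A (0, 1) := by
  rw [← map_smul, ← map_smul, ← map_add]
  simp

/-- Lets determinants in the coordinate frame be evaluated in a frame adapted to the null direction.
-/
theorem det3_clm (A : ℝ × ℝ →L[ℝ] E3) (X Y : ℝ × ℝ) (n : E3) :
    det3 (A X) (A Y) n = (X.1 * Y.2 - X.2 * Y.1) * det3 (A (1, 0)) (A (0, 1)) n := by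
  rw [clm_prod_apply A X, clm_prod_apply A Y]
  simp only [det3_eq, PiLp.add_apply, PiLp.smul_apply, smul_eq_mul]
  ring

/-- A vector orthogonal to a basis vanishes. -/
theorem eq_zero_of_det3_ne_zero {x y z t : E3} (h : det3 x y z ≠ 0) (hx : ⟪x, t⟫ = 0)
    (hy : ⟪y, t⟫ = 0) (hz : ⟪z, t⟫ = 0) : t = 0 := by
  have key : ∀ i : Fin 3, det3 x y z * t i = 0 := by
    simp only [inner_eq_sum] at hx hy hz
    intro i
    rw [det3_eq]
    fin_cases i
    · change _ * t 0 = 0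
      linear_combination (y 1 * z 2 - y 2 * z 1) * hx + (z 1 * x 2 - z 2 * x 1) * hy
        + (x 1 * y 2 - x 2 * y 1) * hz
    · change _ * t 1 = 0
      linear_combination (y 2 * z 0 - y 0 * z 2) * hx + (z 2 * x 0 - z 0 * x 2) * hy
        + (x 2 * y 0 - x 0 * y 2) * hz
    · change _ * t 2 = 0
      linear_combination (y 0 * z 1 - y 1 * z 0) * hx + (z 0 * x 1 - z 1 * x 0) * hy
        + (x 0 * y 1 - x 1 * y 0) * hz
  ext i
  simpa [h] using key i

theorem inner_smul_self_sub (z n : E3) (hn : ‖n‖ = 1) : ⟪n, z - ⟪z, n⟫ • n⟫ = 0 := by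
  rw [inner_sub_right, inner_smul_right, real_inner_self_eq_norm_sq, hn, real_inner_comm]
  ring

theorem eq_smul_normal_of_det3_ne_zero {x y z n : E3} (hn : ‖n‖ = 1) (h : det3 x y n ≠ 0)
    (hx : ⟪x, n⟫ = 0) (hy : ⟪y, n⟫ = 0) (hxz : ⟪x, z⟫ = 0) (hyz : ⟪y, z⟫ = 0) :
    z = ⟪z, n⟫ • n := by
  rw [← sub_eq_zero]
  refine eq_zero_of_det3_ne_zero h ?_ ?_ (inner_smul_self_sub z n hn)
  · rw [inner_sub_right, inner_smul_right, hx, hxz]; ring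
  · rw [inner_sub_right, inner_smul_right, hy, hyz]; ring

/-- A vector of the plane `ν^⊥` that is dependent on the unit vector `n` of that plane. -/
theorem eq_smul_of_det3_eq_zero {z n ν : E3} (hν : ‖ν‖ = 1) (hn : ‖n‖ = 1) (hnν : ⟪n, ν⟫ = 0)
    (hzν : ⟪z, ν⟫ = 0) (h : det3 z n ν = 0) : z = ⟪z, n⟫ • n := by
  have h1 := det3_mul_det3 (z := z) (t := n) hν hzν hnν
  rw [h, real_inner_comm z n, real_inner_self_eq_norm_sq n, hn] at h1
  have h2 : ⟪z - ⟪z, n⟫ • n, z - ⟪z, n⟫ • n⟫ = 0 := by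
    simp only [inner_sub_left, inner_sub_right, inner_smul_left, inner_smul_right,
      real_inner_self_eq_norm_sq n, hn, real_inner_comm z n]
    simp only [conj_trivial]
    linear_combination -h1
  exact sub_eq_zero.1 (inner_self_eq_zero.1 h2)

/-- Two dependent vectors of the plane `ν^⊥` are dependent with explicit coefficients. -/
theorem inner_smul_eq_of_det3_eq_zero {x y ν : E3} (hν : ‖ν‖ = 1) (hx : ⟪x, ν⟫ = 0)
    (hy : ⟪y, ν⟫ = 0) (h : det3 x y ν = 0) (a : E3) : ⟪x, a⟫ • y = ⟪y, a⟫ • x := by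
  have key : ∀ z t : E3, ⟪x, z⟫ * ⟪y, t⟫ = ⟪y, z⟫ * ⟪x, t⟫ := fun z t => by
    have := det3_mul_det3 (z := z) (t := t) hν hx hy
    rw [h] at this
    linarith
  rw [← sub_eq_zero]
  refine ext_inner_right ℝ fun t => ?_
  rw [inner_sub_left, real_inner_smul_left, real_inner_smul_left, inner_zero_left]
  linarith [key a t]

/-! ### Frontals -/

theorem ContDiffOn.fderiv_apply_const {F : Type*} [NormedAddCommGroup F] [NormedSpace ℝ F]
    {U : Set (ℝ × ℝ)} {g : ℝ × ℝ → F} (hg : ContDiffOn ℝ ∞ g U) (hU : IsOpen U) (X : ℝ × ℝ) :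
    ContDiffOn ℝ ∞ (fun q => fderiv ℝ g q X) U :=
  (hg.fderiv_of_isOpen hU (by simp)).clm_apply contDiffOn_const

theorem ContDiffOn.differentiableAt_of_isOpen {F : Type*} [NormedAddCommGroup F] [NormedSpace ℝ F]
    {U : Set (ℝ × ℝ)} {g : ℝ × ℝ → F} (hg : ContDiffOn ℝ ∞ g U) (hU : IsOpen U) {q : ℝ × ℝ}
    (hq : q ∈ U) : DifferentiableAt ℝ g q :=
  (hg.contDiffAt (hU.mem_nhds hq)).differentiableAt (by simp)

theorem ContDiffOn.det3 {U : Set (ℝ × ℝ)} {a b c : ℝ × ℝ → E3} (ha : ContDiffOn ℝ ∞ a U)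
    (hb : ContDiffOn ℝ ∞ b U) (hc : ContDiffOn ℝ ∞ c U) :
    ContDiffOn ℝ ∞ (fun q => det3 (a q) (b q) (c q)) U := by
  have h : ∀ {g : ℝ × ℝ → E3}, ContDiffOn ℝ ∞ g U → ∀ i, ContDiffOn ℝ ∞ (fun q => g q i) U :=
    fun hg => contDiffOn_euclidean.1 hg
  simp only [det3_eq]
  exact (((h ha 0).mul (((h hb 1).mul (h hc 2)).sub ((h hb 2).mul (h hc 1)))).add
    ((h ha 1).mul (((h hb 2).mul (h hc 0)).sub ((h hb 0).mul (h hc 2))))).add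
    ((h ha 2).mul (((h hb 0).mul (h hc 1)).sub ((h hb 1).mul (h hc 0))))

theorem contDiffOn_areaDensity {U : Set (ℝ × ℝ)} {g n : ℝ × ℝ → E3} (hU : IsOpen U)
    (hg : ContDiffOn ℝ ∞ g U) (hn : ContDiffOn ℝ ∞ n U) :
    ContDiffOn ℝ ∞ (areaDensity g n) U :=
  (hg.fderiv_apply_const hU _).det3 (hg.fderiv_apply_const hU _) hn

/-- The mixed area `-(det(g_u, n_v, n) + det(n_u, g_v, n))`, which is `2 H λ` at regular points. -/
noncomputable def mixedDensity (g n : ℝ × ℝ → E3) (q : ℝ × ℝ) : ℝ :=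
  -(det3 (pdU g q) (pdV n q) (n q) + det3 (pdU n q) (pdV g q) (n q))

theorem contDiffOn_mixedDensity {U : Set (ℝ × ℝ)} {g n : ℝ × ℝ → E3} (hU : IsOpen U)
    (hg : ContDiffOn ℝ ∞ g U) (hn : ContDiffOn ℝ ∞ n U) :
    ContDiffOn ℝ ∞ (mixedDensity g n) U :=
  (((hg.fderiv_apply_const hU _).det3 (hn.fderiv_apply_const hU _) hn).add
    ((hn.fderiv_apply_const hU _).det3 (hg.fderiv_apply_const hU _) hn)).neg

theorem fderiv_fderiv_comm {F : Type*} [NormedAddCommGroup F] [NormedSpace ℝ F]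
    {U : Set (ℝ × ℝ)} {g : ℝ × ℝ → F} (hg : ContDiffOn ℝ ∞ g U) (hU : IsOpen U) {q : ℝ × ℝ}
    (hq : q ∈ U) (X Y : ℝ × ℝ) :
    fderiv ℝ (fun x => fderiv ℝ g x X) q Y = fderiv ℝ (fun x => fderiv ℝ g x Y) q X := by
  have hd : DifferentiableAt ℝ (fderiv ℝ g) q :=
    (hg.fderiv_of_isOpen hU (m := ∞) (by simp)).differentiableAt_of_isOpen hU hq
  have h : ∀ Z, fderiv ℝ (fun x => fderiv ℝ g x Z) q = (fderiv ℝ (fderiv ℝ g) q).flip Z :=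
    fun Z => by
      rw [fderiv_clm_apply hd (differentiableAt_const _)]
      simp
  rw [h, h]
  exact (hg.contDiffAt (hU.mem_nhds hq)).isSymmSndFDerivAt
    (by
      rw [minSmoothness_of_isRCLikeNormedField]
      exact WithTop.coe_le_coe.2 (OrderTop.le_top (2 : ℕ∞))) Y X

theorem fderiv_eq_zero_of_eventuallyEq_const {F : Type*} [NormedAddCommGroup F] [NormedSpace ℝ F]
    {g : ℝ × ℝ → F} {q : ℝ × ℝ} {c : F} (h : ∀ᶠ x in 𝓝 q, g x = c) : fderiv ℝ g q = 0 := by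
  rw [Filter.EventuallyEq.fderiv_eq (f₁ := g) (f := fun _ => c) h]
  simp

theorem inner_fderiv_normal {U : Set (ℝ × ℝ)} {n : ℝ × ℝ → E3} (hU : IsOpen U)
    (hn : ContDiffOn ℝ ∞ n U) (h1 : ∀ q ∈ U, ‖n q‖ = 1) {q : ℝ × ℝ} (hq : q ∈ U) (X : ℝ × ℝ) :
    ⟪fderiv ℝ n q X, n q⟫ = 0 := by
  have hd := hn.differentiableAt_of_isOpen hU hq
  have h : fderiv ℝ (fun x => ⟪n x, n x⟫) q = 0 := by
    refine fderiv_eq_zero_of_eventuallyEq_const (c := 1) ?_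
    filter_upwards [hU.mem_nhds hq] with x hx
    rw [real_inner_self_eq_norm_sq, h1 x hx]; norm_num
  have h2 := fderiv_inner_apply ℝ hd hd X
  rw [h, real_inner_comm] at h2
  simp only [zero_apply] at h2
  linarith

/-- Differentiating `⟨a, b⟩ = 0`. -/
theorem inner_fderiv_add_eq_zero {a b : ℝ × ℝ → E3} {q : ℝ × ℝ} (ha : DifferentiableAt ℝ a q)
    (hb : DifferentiableAt ℝ b q) (h : ∀ᶠ x in 𝓝 q, ⟪a x, b x⟫ = 0) (X : ℝ × ℝ) :
    ⟪fderiv ℝ a q X, b q⟫ = -⟪a q, fderiv ℝ b q X⟫ := by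
  have h0 := fderiv_eq_zero_of_eventuallyEq_const h
  have h2 := fderiv_inner_apply ℝ ha hb X
  rw [h0] at h2
  simp only [zero_apply] at h2
  linarith

namespace IsFrontal

variable {S : Set (ℝ × ℝ)} {g n : ℝ × ℝ → E3}

theorem mono {U : Set (ℝ × ℝ)} (h : IsFrontal S g n) (hU : U ⊆ S) : IsFrontal U g n :=
  ⟨h.smooth.mono hU, h.smooth_normal.mono hU, fun q hq => h.norm_eq_one q (hU hq),
    fun q hq => h.orthogonal q (hU hq)⟩

theorem inner_fderiv (h : IsFrontal S g n) (hS : IsOpen S) {q : ℝ × ℝ} (hq : q ∈ S) (X : ℝ × ℝ) :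
    ⟪fderiv ℝ n q X, n q⟫ = 0 :=
  inner_fderiv_normal hS h.smooth_normal h.norm_eq_one hq X

/-- Symmetry of the second fundamental form. -/
theorem inner_fderiv_comm (h : IsFrontal S g n) (hS : IsOpen S) {q : ℝ × ℝ} (hq : q ∈ S)
    (X Y : ℝ × ℝ) : ⟪fderiv ℝ g q X, fderiv ℝ n q Y⟫ = ⟪fderiv ℝ g q Y, fderiv ℝ n q X⟫ := by
  have key : ∀ X Y : ℝ × ℝ, ⟪fderiv ℝ (fun x => fderiv ℝ g x X) q Y, n q⟫
      = -⟪fderiv ℝ g q X, fderiv ℝ n q Y⟫ := fun X Y => by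
    refine inner_fderiv_add_eq_zero ((h.smooth.fderiv_apply_const hS X).differentiableAt_of_isOpen
      hS hq) (h.smooth_normal.differentiableAt_of_isOpen hS hq) ?_ Y
    filter_upwards [hS.mem_nhds hq] with x hx using h.orthogonal x hx X
  have h1 := key X Y
  rw [fderiv_fderiv_comm h.smooth hS hq, key] at h1
  linarith

theorem areaDensity_sq (h : IsFrontal S g n) {q : ℝ × ℝ} (hq : q ∈ S) :
    areaDensity g n q ^ 2 = firstForm g q (1, 0) (1, 0) * firstForm g q (0, 1) (0, 1)
      - firstForm g q (1, 0) (0, 1) ^ 2 := by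
  have := det3_mul_det3 (z := pdU g q) (t := pdV g q) (h.norm_eq_one q hq)
    (h.orthogonal q hq (1, 0)) (h.orthogonal q hq (0, 1))
  unfold areaDensity firstForm
  unfold pdU pdV at *
  rw [real_inner_comm (fderiv ℝ g q (1, 0)) (fderiv ℝ g q (0, 1))] at this
  linarith

theorem areaDensity_mul_areaDensity (h : IsFrontal S g n) (hS : IsOpen S) {q : ℝ × ℝ}
    (hq : q ∈ S) : areaDensity g n q * areaDensity n n q =
      secondForm g n q (1, 0) (1, 0) * secondForm g n q (0, 1) (0, 1)
        - secondForm g n q (1, 0) (0, 1) ^ 2 := by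
  have := det3_mul_det3 (z := pdU n q) (t := pdV n q) (h.norm_eq_one q hq)
    (h.orthogonal q hq (1, 0)) (h.orthogonal q hq (0, 1))
  unfold areaDensity secondForm
  unfold pdU pdV at *
  rw [h.inner_fderiv_comm hS hq (0, 1) (1, 0)] at this
  linarith

theorem areaDensity_mul_mixedDensity (h : IsFrontal S g n) (hS : IsOpen S) {q : ℝ × ℝ}
    (hq : q ∈ S) : areaDensity g n q * mixedDensity g n q =
      firstForm g q (1, 0) (1, 0) * secondForm g n q (0, 1) (0, 1)
      - 2 * firstForm g q (1, 0) (0, 1) * secondForm g n q (1, 0) (0, 1)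
      + firstForm g q (0, 1) (0, 1) * secondForm g n q (1, 0) (1, 0) := by
  have h1 := det3_mul_det3 (z := pdU g q) (t := pdV n q) (h.norm_eq_one q hq)
    (h.orthogonal q hq (1, 0)) (h.orthogonal q hq (0, 1))
  have h2 := det3_mul_det3 (z := pdU n q) (t := pdV g q) (h.norm_eq_one q hq)
    (h.orthogonal q hq (1, 0)) (h.orthogonal q hq (0, 1))
  unfold areaDensity mixedDensity secondForm firstForm
  unfold pdU pdV at *
  rw [h.inner_fderiv_comm hS hq (0, 1) (1, 0)] at h2
  rw [real_inner_comm (fderiv ℝ g q (1, 0)) (fderiv ℝ g q (0, 1))] at h1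
  linarith

theorem injective_fderiv_iff (h : IsFrontal S g n) {q : ℝ × ℝ} (hq : q ∈ S) :
    Function.Injective (fderiv ℝ g q) ↔ areaDensity g n q ≠ 0 := by
  constructor
  · intro hi h0
    have hx := inner_smul_eq_of_det3_eq_zero (h.norm_eq_one q hq)
      (h.orthogonal q hq (1, 0)) (h.orthogonal q hq (0, 1)) h0 (fderiv ℝ g q (0, 1))
    -- When `g_u` and `g_v` are dependent, `⟨g_u, g_v⟩ g_v = |g_v|² g_u`, which exhibits a kernel
    -- vector.
    have hz : fderiv ℝ g q (-⟪fderiv ℝ g q (0, 1), fderiv ℝ g q (0, 1)⟫,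
        ⟪fderiv ℝ g q (1, 0), fderiv ℝ g q (0, 1)⟫) = fderiv ℝ g q 0 := by
      rw [clm_prod_apply, map_zero, hx]
      simp
    have h1 : ⟪fderiv ℝ g q (0, 1), fderiv ℝ g q (0, 1)⟫ = 0 := by
      simpa using congrArg Prod.fst (hi hz)
    have h2 : fderiv ℝ g q (0, 1) = fderiv ℝ g q 0 := by
      rw [inner_self_eq_zero.1 h1, map_zero]
    simpa using congrArg Prod.snd (hi h2)
  · intro h0
    rw [injective_iff_map_eq_zero]
    intro X hX
    have h1 := det3_clm (fderiv ℝ g q) X (0, 1) (n q)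
    have h2 := det3_clm (fderiv ℝ g q) X (1, 0) (n q)
    have hz : ∀ a b : E3, det3 0 a b = 0 := fun a b => by simp [det3_eq]
    rw [hX, hz] at h1 h2
    have h0' : det3 (fderiv ℝ g q (1, 0)) (fderiv ℝ g q (0, 1)) (n q) ≠ 0 := h0
    have e1 : X.1 = 0 := by simpa [h0'] using h1.symm
    have e2 : X.2 = 0 := by simpa [h0'] using h2.symm
    exact Prod.ext e1 e2

theorem mem_regularSet_iff (h : IsFrontal S g n) {q : ℝ × ℝ} :
    q ∈ regularSet S g ↔ q ∈ S ∧ areaDensity g n q ≠ 0 :=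
  and_congr_right fun hq => h.injective_fderiv_iff hq

theorem mem_singularSet_iff (h : IsFrontal S g n) {q : ℝ × ℝ} :
    q ∈ singularSet S g ↔ q ∈ S ∧ areaDensity g n q = 0 :=
  and_congr_right fun hq => (not_congr (h.injective_fderiv_iff hq)).trans not_not

/-- One factor `λ` cancels between `LN - M² = λμ` and `EG - F² = λ²`. At singular points both sides
are `0` by the convention for division by zero. -/
theorem gaussianCurvature_eq (h : IsFrontal S g n) (hS : IsOpen S) {q : ℝ × ℝ} (hq : q ∈ S) :
    gaussianCurvature g n q = areaDensity n n q / areaDensity g n q := by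
  rw [gaussianCurvature, ← h.areaDensity_mul_areaDensity hS hq, ← h.areaDensity_sq hq]
  by_cases h0 : areaDensity g n q = 0
  · simp [h0]
  · field_simp

theorem meanCurvature_eq (h : IsFrontal S g n) (hS : IsOpen S) {q : ℝ × ℝ} (hq : q ∈ S) :
    meanCurvature g n q = mixedDensity g n q / (2 * areaDensity g n q) := by
  rw [meanCurvature, ← h.areaDensity_mul_mixedDensity hS hq, ← h.areaDensity_sq hq]
  by_cases h0 : areaDensity g n q = 0
  · simp [h0]
  · field_simp

/-- Both principal curvatures, as the roots of `λ k² - τ k + μ = 0`. -/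
theorem sign_mul_sqrt_eq (h : IsFrontal S g n) (hS : IsOpen S) {q : ℝ × ℝ} (hq : q ∈ S)
    (h0 : areaDensity g n q ≠ 0) :
    Real.sign (areaDensity g n q) * √(meanCurvature g n q ^ 2 - gaussianCurvature g n q) =
      √(mixedDensity g n q ^ 2 - 4 * areaDensity g n q * areaDensity n n q)
        / (2 * areaDensity g n q) := by
  rw [h.gaussianCurvature_eq hS hq, h.meanCurvature_eq hS hq]
  set a := areaDensity g n q
  have e : (mixedDensity g n q / (2 * a)) ^ 2 - areaDensity n n q / a
      = (mixedDensity g n q ^ 2 - 4 * a * areaDensity n n q) / (2 * a) ^ 2 := by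
    field_simp
    ring
  rw [e, Real.sqrt_div' _ (sq_nonneg _), Real.sqrt_sq_eq_abs]
  -- The root of the denominator is `|2λ|`; the factor `sgn(λ)` turns it into `2λ`.
  rcases lt_or_gt_of_ne h0 with h1 | h1
  · rw [Real.sign_of_neg h1, abs_of_neg (by linarith)]
    rw [div_neg]; ring
  · rw [Real.sign_of_pos h1, abs_of_pos (by linarith)]
    ring

end IsFrontal

/-! ### Functions with a non-degenerate zero and orders of zeros -/

theorem fderiv_ne_zero_of_pd_ne_zero {g : ℝ × ℝ → ℝ} {p : ℝ × ℝ}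
    (h : (pdU g p, pdV g p) ≠ (0, 0)) : fderiv ℝ g p ≠ 0 := fun h0 => by
  simp [pdU, pdV, h0] at h

/-- Near `p` the differential stays nonzero, so the function is not locally constant. This gives the
density of regular points needed to extend identities by continuity. -/
theorem ContDiffOn.eventually_frequently_ne_zero {U : Set (ℝ × ℝ)} {g : ℝ × ℝ → ℝ} {p : ℝ × ℝ}
    (hg : ContDiffOn ℝ ∞ g U) (hU : IsOpen U) (hp : p ∈ U) (h : fderiv ℝ g p ≠ 0) :
    ∀ᶠ q in 𝓝 p, ∃ᶠ x in 𝓝 q, g x ≠ 0 := by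
  have hc : ContinuousAt (fderiv ℝ g) p :=
    (hg.continuousOn_fderiv_of_isOpen hU (by simp)).continuousAt (hU.mem_nhds hp)
  filter_upwards [hc.eventually_ne h] with q hq hz
  exact hq (fderiv_eq_zero_of_eventuallyEq_const (by simpa using hz))

theorem eq_zero_of_frequently_ne_zero {F : Type*} [NormedAddCommGroup F] {U : Set (ℝ × ℝ)}
    {g : ℝ × ℝ → ℝ} {h : ℝ × ℝ → F} {q : ℝ × ℝ} (hU : IsOpen U) (hq : q ∈ U)
    (hg : ∃ᶠ x in 𝓝 q, g x ≠ 0) (hh : ContinuousOn h U) (hz : ∀ x ∈ U, g x ≠ 0 → h x = 0) :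
    h q = 0 := by
  by_contra h0
  have h1 := (hh.continuousAt (hU.mem_nhds hq)).eventually_ne h0
  obtain ⟨x, hx, hx1, hx2⟩ := (hg.and_eventually (h1.and (hU.mem_nhds hq))).exists
  exact hx1 (hz x hx2 hx)

/-- Orders of zeros add up under multiplication. -/
theorem iteratedFDeriv_mul_eq_zero {U : Set (ℝ × ℝ)} {a b : ℝ × ℝ → ℝ} {p : ℝ × ℝ} {m k n : ℕ}
    (hU : IsOpen U) (hp : p ∈ U) (ha : ContDiffOn ℝ ∞ a U) (hb : ContDiffOn ℝ ∞ b U)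
    (h0a : ∀ i < m, iteratedFDeriv ℝ i a p = 0) (h0b : ∀ i < k, iteratedFDeriv ℝ i b p = 0)
    (hn : n < m + k) : iteratedFDeriv ℝ n (fun q => a q * b q) p = 0 := by
  have h := norm_iteratedFDerivWithin_mul_le (n := n) ha hb hU.uniqueDiffOn hp
    (by exact_mod_cast le_top)
  simp only [iteratedFDerivWithin_of_isOpen _ hU hp] at h
  rw [← norm_le_zero_iff]
  refine h.trans (Finset.sum_nonpos fun i hi => ?_)
  rcases lt_or_ge i m with him | him
  · simp [h0a i him]
  · rw [h0b (n - i) (by have := Finset.mem_range.1 hi; omega)]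
    simp

theorem iteratedFDeriv_zero_eq_zero_iff {a : ℝ × ℝ → ℝ} {p : ℝ × ℝ} :
    iteratedFDeriv ℝ 0 a p = 0 ↔ a p = 0 := by
  rw [← norm_eq_zero, norm_iteratedFDeriv_zero, norm_eq_zero]

/-- A quotient whose denominator has a zero of order one at `p` is rationally bounded if and only
if its numerator vanishes at `p`. -/
theorem rationallyBoundedAt_iff {U D : Set (ℝ × ℝ)} {φ a b : ℝ × ℝ → ℝ} {p : ℝ × ℝ}
    (hU : IsOpen U) (hp : p ∈ U) (ha : ContDiffOn ℝ ∞ a U) (hb : ContDiffOn ℝ ∞ b U)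
    (hD : ∀ q, q ∈ D ↔ q ∈ U ∧ b q ≠ 0) (hφ : ∀ q ∈ U, φ q = a q / b q) (hbp : b p = 0)
    (hdb : fderiv ℝ b p ≠ 0) : RationallyBoundedAt D φ p ↔ a p = 0 := by
  constructor
  · rintro ⟨m, W, A, B, hW, hpW, hA, hB, h0A, -, hmB, h⟩
    by_contra h0
    obtain ⟨O, hO, hOo, hpO⟩ := mem_nhds_iff.1 (Filter.inter_mem
      (Filter.inter_mem (hU.mem_nhds hp) (hW.mem_nhds hpW))
      (Filter.inter_mem ((ha.continuousOn.continuousAt (hU.mem_nhds hp)).eventually_ne h0)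
        (hb.eventually_frequently_ne_zero hU hp hdb)))
    have hOU : O ⊆ U := fun x hx => (hO hx).1.1
    have hOW : O ⊆ W := fun x hx => (hO hx).1.2
    have hAb : ContDiffOn ℝ ∞ (fun q => A q * b q) O := (hA.mono hOW).mul (hb.mono hOU)
    have hinv : ContDiffOn ℝ ∞ (fun q => (a q)⁻¹) O := (ha.mono hOU).inv fun x hx => (hO hx).2.1
    -- If `a(p) ≠ 0`, then `A/B = a/b` forces `B = A b a⁻¹` off the zeros of `b`, hence near `p` by
    -- density.
    have hEq : ∀ q ∈ O, B q = A q * b q * (a q)⁻¹ := by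
      intro q hq
      refine sub_eq_zero.1 (eq_zero_of_frequently_ne_zero
        (h := fun q => B q - A q * b q * (a q)⁻¹) hOo hq (hO hq).2.2
        ((hB.mono hOW).sub (hAb.mul hinv)).continuousOn fun x hx hbx => ?_)
      obtain ⟨hBx, hx2⟩ := h x ⟨hOW hx, (hD x).2 ⟨hOU hx, hbx⟩⟩
      have hax : a x ≠ 0 := (hO hx).2.1
      rw [hφ x (hOU hx)] at hx2
      field_simp at hx2 ⊢
      linarith
    refine hmB ?_
    rw [(Filter.EventuallyEq.iteratedFDeriv ℝ
      (Filter.eventually_of_mem (hOo.mem_nhds hpO) hEq) m).eq_of_nhds]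
    -- `A` contributes order at least `m` and `b` at least one, so `B` would vanish to order `m +
    -- 1`.
    refine iteratedFDeriv_mul_eq_zero (m := m + 1) (k := 0) hOo hpO hAb hinv (fun i hi => ?_)
      (fun i hi => absurd hi (by simp)) (by omega)
    refine iteratedFDeriv_mul_eq_zero (m := m) (k := 1) hOo hpO (hA.mono hOW) (hb.mono hOU) h0A
      (fun j hj => ?_) hi
    obtain rfl : j = 0 := by omega
    exact iteratedFDeriv_zero_eq_zero_iff.2 hbp
  · intro h0
    refine ⟨1, U, a, b, hU, hp, ha, hb, fun k hk => ?_, fun k hk => ?_, fun hz => hdb ?_,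
      fun q hq => ⟨((hD q).1 hq.2).2, hφ q hq.1⟩⟩
    · obtain rfl : k = 0 := by omega
      exact iteratedFDeriv_zero_eq_zero_iff.2 h0
    · obtain rfl : k = 0 := by omega
      exact iteratedFDeriv_zero_eq_zero_iff.2 hbp
    · rw [← norm_eq_zero, ← norm_iteratedFDeriv_one, hz, norm_zero]

/-! ### Smooth extension of the principal curvatures -/

theorem extendFrom_eq_of_eqOn {A U : Set (ℝ × ℝ)} {φ ψ : ℝ × ℝ → ℝ} {q : ℝ × ℝ} (hU : IsOpen U)
    (hq : q ∈ U) (hA : q ∈ closure A) (hψ : ContinuousOn ψ U) (h : ∀ x ∈ U, x ∈ A → φ x = ψ x) :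
    extendFrom A φ q = ψ q := by
  refine extendFrom_eq hA ?_
  refine ((hψ.continuousAt (hU.mem_nhds hq)).tendsto.mono_left nhdsWithin_le_nhds).congr' ?_
  filter_upwards [self_mem_nhdsWithin, nhdsWithin_le_nhds (hU.mem_nhds hq)] with x hx1 hx2
  exact (h x hx2 hx1).symm

/-- At `p` the discriminant `τ² - 4λμ` equals `τ(p)² > 0`, so its square root is smooth nearby. The
root `k` with `k(p) = τ(p)` is nonzero; dividing by it avoids dividing by `λ`. -/
theorem IsFrontal.exists_principalCurvatures {S : Set (ℝ × ℝ)} {g n : ℝ × ℝ → E3} {p : ℝ × ℝ}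
    (h : IsFrontal S g n) (hS : IsOpen S) (hp : p ∈ S) (h0 : areaDensity g n p = 0)
    (hd : fderiv ℝ (areaDensity g n) p ≠ 0) (ht : mixedDensity g n p ≠ 0) :
    ∃ (U : Set (ℝ × ℝ)) (k : ℝ × ℝ → ℝ), IsOpen U ∧ p ∈ U ∧ U ⊆ S ∧ ContDiffOn ℝ ∞ k U ∧
      (∀ q ∈ U, k q ≠ 0) ∧
      (∀ q ∈ U, k q ^ 2 - mixedDensity g n q * k q
        + areaDensity g n q * areaDensity n n q = 0) ∧
      (∀ q ∈ U, kappaHat S g n p q = k q) ∧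
      (∀ q ∈ U, boundedPrincipal S g n p q = areaDensity n n q / k q) ∧
      (∀ q ∈ U, areaDensity g n q ≠ 0 →
        unboundedPrincipal S g n p q = k q / areaDensity g n q) := by
  have hl := contDiffOn_areaDensity hS h.smooth h.smooth_normal
  have hm := contDiffOn_areaDensity hS h.smooth_normal h.smooth_normal
  have hτ := contDiffOn_mixedDensity hS h.smooth h.smooth_normal
  set l := areaDensity g n
  set μ := areaDensity n n
  set τ := mixedDensity g n
  have hDs : ContDiffOn ℝ ∞ (fun q => τ q ^ 2 - 4 * l q * μ q) S :=
    (hτ.pow 2).sub ((contDiffOn_const.mul hl).mul hm)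
  -- `s` is the sign of `τ(p)`, chosen so that `τ + s√D` does not cancel at `p`.
  obtain ⟨s, hs2, hs⟩ : ∃ s : ℝ, s * s = 1 ∧ s * τ p = |τ p| ∧
      (s = 1 ∨ s = -1) := by
    rcases lt_or_gt_of_ne ht with h1 | h1
    · exact ⟨-1, by norm_num, by rw [abs_of_neg h1]; ring, Or.inr rfl⟩
    · exact ⟨1, by norm_num, by rw [abs_of_pos h1]; ring, Or.inl rfl⟩
  set D : ℝ × ℝ → ℝ := fun q => τ q ^ 2 - 4 * l q * μ q with hD
  set k : ℝ × ℝ → ℝ := fun q => (τ q + s * √(D q)) / 2 with hk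
  have hDp : D p = τ p ^ 2 := by simp [hD, h0]
  have hkp : k p ≠ 0 := by
    simp only [hk, hDp, Real.sqrt_sq_eq_abs, ← hs.1, ← mul_assoc, hs2]
    ring_nf
    exact ht
  have hDpos : 0 < D p := by rw [hDp]; positivity
  have hev : ∀ᶠ q in 𝓝 p, k q ≠ 0 := by
    have hc : ContinuousAt k p := by
      have e1 := hDs.continuousOn.continuousAt (hS.mem_nhds hp)
      have e2 := hτ.continuousOn.continuousAt (hS.mem_nhds hp)
      exact (e2.add (continuousAt_const.mul e1.sqrt)).div_const 2
    exact hc.eventually_ne hkp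
  obtain ⟨U, hUs, hU, hpU⟩ := mem_nhds_iff.1 (Filter.inter_mem
    (Filter.inter_mem (hS.mem_nhds hp) hev)
    (Filter.inter_mem ((hDs.continuousOn.continuousAt (hS.mem_nhds hp)).eventually_ne hDpos.ne')
      (Filter.inter_mem ((hDs.continuousOn.continuousAt (hS.mem_nhds hp)).eventually_const_lt hDpos)
        (hl.eventually_frequently_ne_zero hS hp hd))))
  have hUS : U ⊆ S := fun q hq => (hUs hq).1.1
  have hksm : ContDiffOn ℝ ∞ k U :=
    ((hτ.mono hUS).add (contDiffOn_const.mul ((hDs.mono hUS).sqrt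
      fun q hq => (hUs hq).2.1))).div_const 2
  have hk0 : ∀ q ∈ U, k q ≠ 0 := fun q hq => (hUs hq).1.2
  have hquad : ∀ q ∈ U, k q ^ 2 - τ q * k q + l q * μ q = 0 := fun q hq => by
    have e : √(D q) * √(D q) = D q := Real.mul_self_sqrt (hUs hq).2.2.1.le
    simp only [hk]
    have e2 : D q = τ q ^ 2 - 4 * l q * μ q := rfl
    rw [e2] at e ⊢
    linear_combination (1 / 4) * e + (1 / 4) * √(τ q ^ 2 - 4 * l q * μ q) ^ 2 * hs2
  have hother : ∀ q ∈ U, l q ≠ 0 → (τ q - s * √(D q)) / (2 * l q) = μ q / k q := fun q hq hlq => by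
    have := hquad q hq
    have e : τ q - s * √(D q) = 2 * (τ q - k q) := by simp only [hk]; ring
    rw [e, div_eq_div_iff (by simpa using hlq) (hk0 q hq)]
    linarith
  have hone : ∀ q ∈ U, l q ≠ 0 → (τ q + s * √(D q)) / (2 * l q) = k q / l q := fun q hq hlq => by
    simp only [hk]
    field_simp
  have hP1 : ∀ q ∈ U, l q ≠ 0 → principalCurvature₁ g n q = (τ q + √(D q)) / (2 * l q) :=
    fun q hq hlq => by
      rw [principalCurvature₁, h.sign_mul_sqrt_eq hS (hUS hq) hlq, h.meanCurvature_eq hS (hUS hq),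
        ← add_div]
  have hP2 : ∀ q ∈ U, l q ≠ 0 → principalCurvature₂ g n q = (τ q - √(D q)) / (2 * l q) :=
    fun q hq hlq => by
      rw [principalCurvature₂, h.sign_mul_sqrt_eq hS (hUS hq) hlq, h.meanCurvature_eq hS (hUS hq),
        ← sub_div]
  have hκsm : ContDiffOn ℝ ∞ (fun q => μ q / k q) U := (hm.mono hUS).div hksm hk0
  have hreg : ∀ q, q ∈ regularSet S g ↔ q ∈ S ∧ l q ≠ 0 := fun q => h.mem_regularSet_iff
  have hcases : ∀ q ∈ U, l q ≠ 0 → boundedPrincipalAux S g n p q = μ q / k q ∧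
      unboundedPrincipal S g n p q = k q / l q := by
    intro q hq hlq
    -- Which principal curvature is unbounded depends on the sign of `τ(p)`: the first one if `s =
    -- 1`, the second if `s = -1`.
    rcases hs.2 with rfl | rfl
    · have hnb : ¬ IsBoundedNear (regularSet S g) (principalCurvature₁ g n) p := by
        rintro ⟨W, hW, c, hc⟩
        have hlt : ∀ᶠ x in 𝓝 p, c * |l x| < |k x| := by
          have e1 : ContinuousAt (fun x => c * |l x|) p := continuousAt_const.mul
            (hl.continuousOn.continuousAt (hS.mem_nhds hp)).abs
          have e2 : ContinuousAt (fun x => |k x|) p :=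
            (hksm.continuousOn.continuousAt (hU.mem_nhds hpU)).abs
          refine e1.tendsto.eventually_lt e2.tendsto ?_
          rw [h0]
          simpa using hkp
        obtain ⟨x, hx, hx1, hx2, hx3⟩ := ((hUs hpU).2.2.2.and_eventually
          (hlt.and (Filter.inter_mem hW (hU.mem_nhds hpU)))).exists
        have h2 := hc x ⟨hx2, (hreg x).2 ⟨hUS hx3, hx⟩⟩
        have h3 := hone x hx3 hx
        rw [one_mul] at h3
        rw [hP1 x hx3 hx, h3, abs_div, div_le_iff₀ (abs_pos.2 hx)] at h2
        linarith
      rw [boundedPrincipalAux, unboundedPrincipal, if_neg hnb, if_neg hnb, hP1 q hq hlq,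
        hP2 q hq hlq, ← hone q hq hlq, ← hother q hq hlq, one_mul]
      exact ⟨rfl, rfl⟩
    · have hPb : ∀ x ∈ U, l x ≠ 0 → principalCurvature₁ g n x = μ x / k x := fun x hx hlx => by
        rw [hP1 x hx hlx, ← hother x hx hlx]
        ring
      have hb : IsBoundedNear (regularSet S g) (principalCurvature₁ g n) p := by
        have hc := (hκsm.continuousOn.continuousAt (hU.mem_nhds hpU)).abs
        refine ⟨_, Filter.inter_mem (hU.mem_nhds hpU) (hc.eventually_lt_const (lt_add_one _)),
          |μ p / k p| + 1, fun x hx => ?_⟩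
        rw [hPb x hx.1.1 ((hreg x).1 hx.2).2]
        exact le_of_lt hx.1.2
      rw [boundedPrincipalAux, unboundedPrincipal, if_pos hb, if_pos hb, hPb q hq hlq,
        hP2 q hq hlq, ← hone q hq hlq]
      exact ⟨rfl, by ring⟩
  have hcl : ∀ q ∈ U, q ∈ closure (regularSet S g) := fun q hq =>
    mem_closure_iff_frequently.2 (((hUs hq).2.2.2.and_eventually (hU.mem_nhds hq)).mono
      fun x hx => (hreg x).2 ⟨hUS hx.2, hx.1⟩)
  refine ⟨U, k, hU, hpU, hUS, hksm, hk0, hquad, fun q hq => ?_, fun q hq => ?_,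
    fun q hq hlq => (hcases q hq hlq).2⟩
  · refine extendFrom_eq_of_eqOn hU hq (hcl q hq) hksm.continuousOn fun x hx hxA => ?_
    have hlx := ((hreg x).1 hxA).2
    change l x * _ = _
    rw [(hcases x hx hlx).2]
    field_simp
  · exact extendFrom_eq_of_eqOn hU hq (hcl q hq) hκsm.continuousOn fun x hx hxA =>
      (hcases x hx ((hreg x).1 hxA).2).1

/-! ### Focal surfaces -/

/-- Applied to `df + ρ dν` and `dν + κ df`, it turns degeneracy into the quadratic equation of the
principal curvatures. -/
theorem det3_pencil (x y x' y' n : E3) (r : ℝ) : det3 (x + r • x') (y + r • y') n =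
    det3 x y n + r * (det3 x y' n + det3 x' y n) + r ^ 2 * det3 x' y' n := by
  simp only [det3_eq, PiLp.add_apply, PiLp.smul_apply, smul_eq_mul]
  ring

theorem det3_smul_right (x y n : E3) (r : ℝ) : det3 x (r • y) n = r * det3 x y n := by
  simp only [det3_eq, PiLp.smul_apply, smul_eq_mul]
  ring

theorem fderiv_smul_apply_real {F : Type*} [NormedAddCommGroup F] [NormedSpace ℝ F]
    {r : ℝ × ℝ → ℝ} {g : ℝ × ℝ → F} {q : ℝ × ℝ} (hr : DifferentiableAt ℝ r q)
    (hg : DifferentiableAt ℝ g q) (X : ℝ × ℝ) :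
    fderiv ℝ (fun x => r x • g x) q X = r q • fderiv ℝ g q X + fderiv ℝ r q X • g q := by
  rw [fderiv_fun_smul hr hg]
  simp

theorem fderiv_add_smul_apply {F : Type*} [NormedAddCommGroup F] [NormedSpace ℝ F]
    {r : ℝ × ℝ → ℝ} {e g : ℝ × ℝ → F} {q : ℝ × ℝ} (he : DifferentiableAt ℝ e q)
    (hr : DifferentiableAt ℝ r q) (hg : DifferentiableAt ℝ g q) (X : ℝ × ℝ) :
    fderiv ℝ (fun x => e x + r x • g x) q X =
      fderiv ℝ e q X + r q • fderiv ℝ g q X + fderiv ℝ r q X • g q := by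
  rw [fderiv_fun_add he (hr.fun_smul hg), add_assoc, ← fderiv_smul_apply_real hr hg]
  rfl

namespace IsFrontal

variable {U : Set (ℝ × ℝ)} {f ν : ℝ × ℝ → E3} {ρ κ : ℝ × ℝ → ℝ} {V : ℝ × ℝ → ℝ × ℝ} {p : ℝ × ℝ}

/-- If the differential `df + ρ dν` degenerates everywhere and has rank one at `p`, its kernel is
spanned by a smooth vector field near `p`. -/
theorem exists_kernelField (h : IsFrontal U f ν) (hU : IsOpen U) (hp : p ∈ U)
    (hρ : ContDiffOn ℝ ∞ ρ U) (hρp : ρ p = 0)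
    (hdet : ∀ q ∈ U, det3 (pdU f q + ρ q • pdU ν q) (pdV f q + ρ q • pdV ν q) (ν q) = 0)
    {w : ℝ × ℝ} (hw : fderiv ℝ f p w ≠ 0) :
    ∃ (O : Set (ℝ × ℝ)) (V : ℝ × ℝ → ℝ × ℝ), IsOpen O ∧ p ∈ O ∧ O ⊆ U ∧ ContDiffOn ℝ ∞ V O ∧
      ∀ q ∈ O, V q ≠ 0 ∧ fderiv ℝ f q (V q) + ρ q • fderiv ℝ ν q (V q) = 0 := by
  set a := fderiv ℝ f p w with ha
  set P : ℝ × ℝ → E3 := fun q => pdU f q + ρ q • pdU ν q with hP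
  set Q : ℝ × ℝ → E3 := fun q => pdV f q + ρ q • pdV ν q with hQ
  have hPs : ContDiffOn ℝ ∞ P U := (h.smooth.fderiv_apply_const hU _).add
    (hρ.smul (h.smooth_normal.fderiv_apply_const hU _))
  have hQs : ContDiffOn ℝ ∞ Q U := (h.smooth.fderiv_apply_const hU _).add
    (hρ.smul (h.smooth_normal.fderiv_apply_const hU _))
  -- `P` and `Q` are dependent, so `⟪P, a⟫ Q = ⟪Q, a⟫ P` and these coefficients give a kernel
  -- vector. Both cannot vanish at `p`, since `a ≠ 0` is a combination of `P(p)` and `Q(p)`.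
  set V : ℝ × ℝ → ℝ × ℝ := fun q => (-⟪Q q, a⟫, ⟪P q, a⟫) with hVdef
  have hV : ContDiffOn ℝ ∞ V U :=
    ((hQs.inner ℝ contDiffOn_const).neg).prodMk (hPs.inner ℝ contDiffOn_const)
  have hVp : V p ≠ 0 := by
    intro h0
    simp only [hVdef, hP, hQ, hρp, zero_smul, add_zero, Prod.mk_eq_zero, neg_eq_zero] at h0
    have : ⟪a, a⟫ = 0 := by
      nth_rewrite 1 [ha]
      rw [clm_prod_apply, inner_add_left, real_inner_smul_left, real_inner_smul_left]
      unfold pdU pdV at h0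
      rw [h0.1, h0.2]
      ring
    exact hw (inner_self_eq_zero.1 this)
  obtain ⟨O, hO, hOo, hpO⟩ := mem_nhds_iff.1 (Filter.inter_mem (hU.mem_nhds hp)
    ((hV.continuousOn.continuousAt (hU.mem_nhds hp)).eventually_ne hVp))
  refine ⟨O, V, hOo, hpO, fun q hq => (hO hq).1, hV.mono fun q hq => (hO hq).1,
    fun q hq => ⟨(hO hq).2, ?_⟩⟩
  have hqU := (hO hq).1
  have hPν : ∀ X, ⟪fderiv ℝ f q X + ρ q • fderiv ℝ ν q X, ν q⟫ = 0 := fun X => by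
    rw [inner_add_left, real_inner_smul_left, h.orthogonal q hqU, h.inner_fderiv hU hqU]
    ring
  have key := inner_smul_eq_of_det3_eq_zero (h.norm_eq_one q hqU) (hPν (1, 0)) (hPν (0, 1))
    (hdet q hqU) a
  have e : fderiv ℝ f q (V q) + ρ q • fderiv ℝ ν q (V q) = -⟪Q q, a⟫ • P q + ⟪P q, a⟫ • Q q := by
    rw [clm_prod_apply (fderiv ℝ f q), clm_prod_apply (fderiv ℝ ν q)]
    simp only [hVdef, hP, hQ, pdU, pdV]
    module
  rw [e, neg_smul, neg_add_eq_zero]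
  exact key.symm

theorem fderiv_focal (h : IsFrontal U f ν) (hU : IsOpen U) (hρ : ContDiffOn ℝ ∞ ρ U)
    {q : ℝ × ℝ} (hq : q ∈ U) (X : ℝ × ℝ) :
    fderiv ℝ (fun x => f x + ρ x • ν x) q X =
      fderiv ℝ f q X + ρ q • fderiv ℝ ν q X + fderiv ℝ ρ q X • ν q :=
  fderiv_add_smul_apply (h.smooth.differentiableAt_of_isOpen hU hq)
    (hρ.differentiableAt_of_isOpen hU hq) (h.smooth_normal.differentiableAt_of_isOpen hU hq) X

/-- By symmetry of the second fundamental form, `⟨df(X) + ρ dν(X), dν(v)⟩ = ⟨df(v) + ρ dν(v), dν(X)⟩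
= 0`; the remaining term is a multiple of `ν`, which is orthogonal to `dν(v)`. -/
theorem inner_fderiv_focal_eq_zero (h : IsFrontal U f ν) (hU : IsOpen U)
    (hρ : ContDiffOn ℝ ∞ ρ U) {q : ℝ × ℝ} (hq : q ∈ U) {v : ℝ × ℝ}
    (hv : fderiv ℝ f q v + ρ q • fderiv ℝ ν q v = 0) (X : ℝ × ℝ) :
    ⟪fderiv ℝ (fun x => f x + ρ x • ν x) q X, fderiv ℝ ν q v⟫ = 0 := by
  have h1 : ⟪fderiv ℝ f q v + ρ q • fderiv ℝ ν q v, fderiv ℝ ν q X⟫ = 0 := by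
    rw [hv, inner_zero_left]
  rw [inner_add_left, real_inner_smul_left] at h1
  rw [h.fderiv_focal hU hρ hq, inner_add_left, inner_add_left, real_inner_smul_left,
    real_inner_smul_left, h.inner_fderiv_comm hU hq X v, real_inner_comm (fderiv ℝ ν q v) (ν q),
    h.inner_fderiv hU hq, real_inner_comm (fderiv ℝ ν q v) (fderiv ℝ ν q X)]
  linarith

/-- The focal surface is a frontal with unit normal `dν(V) / |dν(V)|`. -/
theorem exists_focal_isFrontal (h : IsFrontal U f ν) (hU : IsOpen U) (hp : p ∈ U)
    (hρ : ContDiffOn ℝ ∞ ρ U) (hV : ContDiffOn ℝ ∞ V U)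
    (hker : ∀ q ∈ U, fderiv ℝ f q (V q) + ρ q • fderiv ℝ ν q (V q) = 0)
    (hVp : fderiv ℝ ν p (V p) ≠ 0) :
    ∃ (O : Set (ℝ × ℝ)) (n : ℝ × ℝ → E3), IsOpen O ∧ p ∈ O ∧ O ⊆ U ∧
      IsFrontal O (fun q => f q + ρ q • ν q) n := by
  have hνV : ContDiffOn ℝ ∞ (fun q => fderiv ℝ ν q (V q)) U :=
    (h.smooth_normal.fderiv_of_isOpen hU (by simp)).clm_apply hV
  obtain ⟨O, hO, hOo, hpO⟩ := mem_nhds_iff.1 (Filter.inter_mem (hU.mem_nhds hp)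
    ((hνV.continuousOn.continuousAt (hU.mem_nhds hp)).eventually_ne hVp))
  have hOU : O ⊆ U := fun q hq => (hO hq).1
  have hne : ∀ q ∈ O, fderiv ℝ ν q (V q) ≠ 0 := fun q hq => (hO hq).2
  refine ⟨O, fun q => ‖fderiv ℝ ν q (V q)‖⁻¹ • fderiv ℝ ν q (V q), hOo, hpO, hOU,
    (h.smooth.add (hρ.smul h.smooth_normal)).mono hOU, ?_, fun q hq => ?_, fun q hq X => ?_⟩
  · exact (((hνV.mono hOU).norm ℝ hne).inv fun q hq => norm_ne_zero_iff.2 (hne q hq)).smul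
      (hνV.mono hOU)
  · rw [norm_smul, norm_inv, norm_norm, inv_mul_cancel₀ (norm_ne_zero_iff.2 (hne q hq))]
  · rw [real_inner_smul_right, h.inner_fderiv_focal_eq_zero hU hρ (hOU hq) (hker q (hOU hq)),
      mul_zero]

/-- Any unit normal field of a focal surface with a non-degenerate singularity is proportional to
`dν(V)`. -/
theorem eventually_eq_smul_normal (h : IsFrontal U f ν) (hU : IsOpen U) (hp : p ∈ U)
    (hρ : ContDiffOn ℝ ∞ ρ U) (hV : ContDiffOn ℝ ∞ V U)
    (hker : ∀ q ∈ U, fderiv ℝ f q (V q) + ρ q • fderiv ℝ ν q (V q) = 0) {n : ℝ × ℝ → E3}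
    (hn : IsFrontal U (fun q => f q + ρ q • ν q) n)
    (hnd : fderiv ℝ (areaDensity (fun q => f q + ρ q • ν q) n) p ≠ 0) :
    ∀ᶠ q in 𝓝 p, fderiv ℝ ν q (V q) = ⟪fderiv ℝ ν q (V q), n q⟫ • n q := by
  have hνV : ContDiffOn ℝ ∞ (fun q => fderiv ℝ ν q (V q)) U :=
    (h.smooth_normal.fderiv_of_isOpen hU (by simp)).clm_apply hV
  filter_upwards [hU.mem_nhds hp, (contDiffOn_areaDensity hU hn.smooth
    hn.smooth_normal).eventually_frequently_ne_zero hU hp hnd] with q hq hfreq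
  refine sub_eq_zero.1 (eq_zero_of_frequently_ne_zero
    (h := fun q => fderiv ℝ ν q (V q) - ⟪fderiv ℝ ν q (V q), n q⟫ • n q) hU hq hfreq
    (hνV.sub ((hνV.inner ℝ hn.smooth_normal).smul hn.smooth_normal)).continuousOn
    fun x hx hx0 => sub_eq_zero.2 ?_)
  -- At a regular point of the focal surface, `dν(V)` is orthogonal to the whole tangent plane.
  exact eq_smul_normal_of_det3_ne_zero (hn.norm_eq_one x hx) hx0 (hn.orthogonal x hx _)
    (hn.orthogonal x hx _) (h.inner_fderiv_focal_eq_zero hU hρ hx (hker x hx) _)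
    (h.inner_fderiv_focal_eq_zero hU hρ hx (hker x hx) _)

/-- The second fundamental form of the focal surface at a singular point, in terms of the
derivative of the other principal curvature. -/
theorem secondForm_focal (h : IsFrontal U f ν) (hU : IsOpen U) (hp : p ∈ U)
    (hρ : ContDiffOn ℝ ∞ ρ U) (hκ : ContDiffOn ℝ ∞ κ U) (hV : ContDiffOn ℝ ∞ V U)
    (hker : ∀ q ∈ U, fderiv ℝ f q (V q) + ρ q • fderiv ℝ ν q (V q) = 0)
    (hdet : ∀ q ∈ U, det3 (pdU ν q + κ q • pdU f q) (pdV ν q + κ q • pdV f q) (ν q) = 0)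
    (hρp : ρ p = 0) (hρV : fderiv ℝ ρ p (V p) = 0) (hVp : fderiv ℝ ν p (V p) ≠ 0)
    {n : ℝ × ℝ → E3} (hn : IsFrontal U (fun q => f q + ρ q • ν q) n)
    (hnd : fderiv ℝ (areaDensity (fun q => f q + ρ q • ν q) n) p ≠ 0) :
    ⟪fderiv ℝ ν p (V p), n p⟫ ≠ 0 ∧ (∀ᶠ q in 𝓝 p, ⟪n q, ν q⟫ = 0) ∧
      ∀ w, fderiv ℝ κ p (V p) * ⟪fderiv ℝ f p w, fderiv ℝ f p w⟫ =
        ⟪fderiv ℝ ν p (V p), n p⟫ * secondForm (fun q => f q + ρ q • ν q) n p w w := by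
  have hpar := h.eventually_eq_smul_normal hU hp hρ hV hker hn hnd
  have hνV : ContDiffOn ℝ ∞ (fun q => fderiv ℝ ν q (V q)) U :=
    (h.smooth_normal.fderiv_of_isOpen hU (by simp)).clm_apply hV
  have hNp : ⟪fderiv ℝ ν p (V p), n p⟫ ≠ 0 := fun h0 => hVp (by
    rw [hpar.self_of_nhds, h0, zero_smul])
  have hN : ∀ᶠ q in 𝓝 p, ⟪fderiv ℝ ν q (V q), n q⟫ ≠ 0 :=
    ((hνV.inner ℝ hn.smooth_normal).continuousOn.continuousAt (hU.mem_nhds hp)).eventually_ne hNp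
  have hnν : ∀ᶠ q in 𝓝 p, ⟪n q, ν q⟫ = 0 := by
    filter_upwards [hpar, hN, hU.mem_nhds hp] with q h1 h2 hq
    have := h.inner_fderiv hU hq (V q)
    rw [h1, real_inner_smul_left] at this
    exact (mul_eq_zero.1 this).resolve_left h2
  refine ⟨hNp, hnν, fun w => ?_⟩
  have hκρ : ∀ᶠ q in 𝓝 p, 1 - κ q * ρ q ≠ 0 :=
    ((contDiffOn_const.sub (hκ.mul hρ)).continuousOn.continuousAt (hU.mem_nhds hp)).eventually_ne
      (by simp [hρp])
  set G : ℝ × ℝ → ℝ × ℝ → E3 := fun X q => fderiv ℝ ν q X + κ q • fderiv ℝ f q X with hG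
  -- `dν + κ df` has rank at most one, and on `V` it equals `(1 - κρ) dν(V)`, a nonzero multiple of
  -- `n`. So its image is the line of `n`.
  have hline : ∀ X, ∀ᶠ q in 𝓝 p, G X q = ⟪G X q, n q⟫ • n q := by
    intro X
    filter_upwards [hpar, hN, hU.mem_nhds hp, hnν, hκρ] with q h1 h2 hq h3 h4
    refine eq_smul_of_det3_eq_zero (h.norm_eq_one q hq) (hn.norm_eq_one q hq) h3 ?_ ?_
    · simp only [hG]
      rw [inner_add_left, real_inner_smul_left, h.orthogonal q hq, h.inner_fderiv hU hq]
      ring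
    · have hd := det3_clm (fderiv ℝ ν q + κ q • fderiv ℝ f q) X (V q) (ν q)
      have hz : det3 ((fderiv ℝ ν q + κ q • fderiv ℝ f q) (1, 0))
        ((fderiv ℝ ν q + κ q • fderiv ℝ f q) (0, 1)) (ν q) = 0 := hdet q hq
      have hGV : (fderiv ℝ ν q + κ q • fderiv ℝ f q) (V q) =
          ((1 - κ q * ρ q) * ⟪fderiv ℝ ν q (V q), n q⟫) • n q := by
        rw [mul_smul, ← h1]
        change fderiv ℝ ν q (V q) + κ q • fderiv ℝ f q (V q) = _
        rw [eq_neg_of_add_eq_zero_left (hker q hq)]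
        module
      rw [hz, mul_zero, hGV, det3_smul_right] at hd
      exact (mul_eq_zero.1 hd).resolve_left (mul_ne_zero h4 h2)
  have hGs : ∀ X, ContDiffOn ℝ ∞ (G X) U := fun X =>
    (h.smooth_normal.fderiv_apply_const hU X).add (hκ.smul (h.smooth.fderiv_apply_const hU X))
  have hkerp : fderiv ℝ f p (V p) = 0 := by
    have := hker p hp
    rwa [hρp, zero_smul, add_zero] at this
  have hC : ∀ X, fderiv ℝ (fun q => f q + ρ q • ν q) p X =
      fderiv ℝ f p X + fderiv ℝ ρ p X • ν p := fun X => by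
    rw [h.fderiv_focal hU hρ hp, hρp, zero_smul, add_zero]
  have hfn : ∀ X, ⟪fderiv ℝ f p X, n p⟫ = 0 := fun X => by
    have := hn.orthogonal p hp X
    rwa [hC, inner_add_left, real_inner_smul_left, real_inner_comm (n p) (ν p), hnν.self_of_nhds,
      mul_zero, add_zero] at this
  -- Differentiating `G X = ⟪G X, n⟫ n` and pairing with `df(w) ⟂ n` removes the derivative of the
  -- coefficient.
  have hderiv : ∀ X Y, ⟪fderiv ℝ (fun q => fderiv ℝ ν q X) p Y, fderiv ℝ f p w⟫
      + κ p * ⟪fderiv ℝ (fun q => fderiv ℝ f q X) p Y, fderiv ℝ f p w⟫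
      + fderiv ℝ κ p Y * ⟪fderiv ℝ f p X, fderiv ℝ f p w⟫
      = ⟪G X p, n p⟫ * ⟪fderiv ℝ n p Y, fderiv ℝ f p w⟫ := by
    intro X Y
    have e1 := fderiv_add_smul_apply
      ((h.smooth_normal.fderiv_apply_const hU X).differentiableAt_of_isOpen hU hp)
      (hκ.differentiableAt_of_isOpen hU hp)
      ((h.smooth.fderiv_apply_const hU X).differentiableAt_of_isOpen hU hp) Y
    have e2 := fderiv_smul_apply_real
      (((hGs X).inner ℝ hn.smooth_normal).differentiableAt_of_isOpen hU hp)
      (hn.smooth_normal.differentiableAt_of_isOpen hU hp) Y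
    have e3 : fderiv ℝ (G X) p = fderiv ℝ (fun q => ⟪G X q, n q⟫ • n q) p :=
      Filter.EventuallyEq.fderiv_eq (hline X)
    have e4 : ⟪fderiv ℝ (G X) p Y, fderiv ℝ f p w⟫ =
        ⟪fderiv ℝ (fun q => ⟪G X q, n q⟫ • n q) p Y, fderiv ℝ f p w⟫ := by rw [e3]
    rw [e2] at e4
    simp only [hG] at e4 ⊢
    rw [e1] at e4
    simp only [inner_add_left, real_inner_smul_left] at e4 ⊢
    rw [real_inner_comm (fderiv ℝ f p w) (n p)] at e4
    simp only [hfn] at e4 ⊢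
    linarith
  -- In the difference of these two instances the second derivatives of `ν` and `f` cancel.
  have d1 := hderiv w (V p)
  have d2 := hderiv (V p) w
  have hGV : ⟪G (V p) p, n p⟫ = ⟪fderiv ℝ ν p (V p), n p⟫ := by
    simp only [hG, hkerp, smul_zero, add_zero]
  have hGw : ⟪G w p, n p⟫ = ⟪fderiv ℝ ν p w, n p⟫ := by
    simp only [hG]
    rw [inner_add_left, real_inner_smul_left, hfn, mul_zero, add_zero]
  rw [fderiv_fderiv_comm h.smooth_normal hU hp, fderiv_fderiv_comm h.smooth hU hp, hGw] at d1
  rw [hkerp, inner_zero_left, mul_zero, add_zero, hGV] at d2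
  have hnν' : ∀ X, ⟪fderiv ℝ n p X, ν p⟫ = -⟪fderiv ℝ ν p X, n p⟫ := fun X => by
    rw [real_inner_comm (n p)]
    exact inner_fderiv_add_eq_zero (hn.smooth_normal.differentiableAt_of_isOpen hU hp)
      (h.smooth_normal.differentiableAt_of_isOpen hU hp) hnν X
  -- At `p`, `V` is null for the focal surface, hence in the kernel of its second fundamental form.
  -- This expresses `⟨dn(V), df(w)⟩` through `dρ(w)`.
  have hcross : ⟪fderiv ℝ (fun q => f q + ρ q • ν q) p w, fderiv ℝ n p (V p)⟫ = 0 := by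
    rw [hn.inner_fderiv_comm hU hp, hC, hkerp, hρV]
    simp
  rw [hC, inner_add_left, real_inner_smul_left, real_inner_comm, real_inner_comm _ (ν p), hnν']
    at hcross
  have hself : secondForm (fun q => f q + ρ q • ν q) n p w w =
      -⟪fderiv ℝ n p w, fderiv ℝ f p w⟫ + fderiv ℝ ρ p w * ⟪fderiv ℝ ν p w, n p⟫ := by
    rw [secondForm, hC, inner_add_left, real_inner_smul_left, real_inner_comm,
      real_inner_comm _ (ν p), hnν']
    ring
  rw [hself]
  linear_combination d1 - d2 + ⟪fderiv ℝ ν p w, n p⟫ * hcross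

/-- The density `det(n_u, n_v, n)` of the Gauss map of the focal surface vanishes at `p` together
with its second fundamental form. -/
theorem areaDensity_normal_focal (h : IsFrontal U f ν) (hU : IsOpen U) (hp : p ∈ U)
    (hρ : ContDiffOn ℝ ∞ ρ U) {v : ℝ × ℝ} (hker : fderiv ℝ f p v = 0)
    (hρp : ρ p = 0) (hρv : fderiv ℝ ρ p v = 0) {n : ℝ × ℝ → E3}
    (hn : IsFrontal U (fun q => f q + ρ q • ν q) n) (hN : ⟪fderiv ℝ ν p v, n p⟫ ≠ 0)
    (hnν : ∀ᶠ q in 𝓝 p, ⟪n q, ν q⟫ = 0) {w : ℝ × ℝ} (hw : fderiv ℝ f p w ≠ 0) :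
    areaDensity n n p = 0 ↔ secondForm (fun q => f q + ρ q • ν q) n p w w = 0 := by
  have hC : ∀ X, fderiv ℝ (fun q => f q + ρ q • ν q) p X =
      fderiv ℝ f p X + fderiv ℝ ρ p X • ν p := fun X => by
    rw [h.fderiv_focal hU hρ hp, hρp, zero_smul, add_zero]
  have hnp := hn.norm_eq_one p hp
  have hνn : ⟪ν p, n p⟫ = 0 := by rw [real_inner_comm]; exact hnν.self_of_nhds
  have hcross : ⟪fderiv ℝ n p v, fderiv ℝ (fun q => f q + ρ q • ν q) p w⟫ = 0 := by
    rw [real_inner_comm, hn.inner_fderiv_comm hU hp, hC, hker, hρv]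
    simp
  have hnv : ⟪fderiv ℝ n p v, ν p⟫ = -⟪fderiv ℝ ν p v, n p⟫ := by
    rw [real_inner_comm (n p)]
    exact inner_fderiv_add_eq_zero (hn.smooth_normal.differentiableAt_of_isOpen hU hp)
      (h.smooth_normal.differentiableAt_of_isOpen hU hp) hnν v
  -- `ν` and `dC(w) = df(w) + dρ(w) ν` span the plane `n^⊥`: their Gram determinant against `ν,
  -- df(w)` is `|df(w)|² ≠ 0`.
  have hd : det3 (ν p) (fderiv ℝ (fun q => f q + ρ q • ν q) p w) (n p) ≠ 0 := by
    intro h0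
    have e := det3_mul_det3 (z := ν p) (t := fderiv ℝ f p w) hnp hνn (hn.orthogonal p hp w)
    rw [h0, hC] at e
    simp only [inner_add_left, real_inner_smul_left, real_inner_self_eq_norm_sq,
      h.norm_eq_one p hp, h.orthogonal p hp w, real_inner_comm (fderiv ℝ f p w) (ν p)] at e
    have : ‖fderiv ℝ f p w‖ ^ 2 = 0 := by linarith
    exact hw (norm_eq_zero.1 (pow_eq_zero_iff two_ne_zero |>.1 this))
  have e := det3_mul_det3 (z := ν p) (t := fderiv ℝ (fun q => f q + ρ q • ν q) p w) hnp
    (hn.inner_fderiv hU hp v) (hn.inner_fderiv hU hp w)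
  rw [hcross, zero_mul, sub_zero, hnv, det3_clm,
    real_inner_comm _ (fderiv ℝ n p w)] at e
  have hcoef : v.1 * w.2 - v.2 * w.1 ≠ 0 := by
    intro h0
    have hv0 : v ≠ 0 := fun hv => hN (by simp [hv])
    have e1 : v.1 • w = w.1 • v := Prod.ext (by simp [mul_comm]) (by
      simp only [Prod.smul_snd, smul_eq_mul]; linarith)
    have e2 : v.2 • w = w.2 • v := Prod.ext (by simp only [Prod.smul_fst, smul_eq_mul]; linarith)
      (by simp [mul_comm])
    have f1 := congrArg (fderiv ℝ f p) e1
    have f2 := congrArg (fderiv ℝ f p) e2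
    rw [map_smul, map_smul, hker, smul_zero, smul_eq_zero] at f1 f2
    exact hv0 (Prod.ext (f1.resolve_right hw) (f2.resolve_right hw))
  -- The Gram matrix of `dn(v), dn(w)` against `ν, dC(w)` is triangular, because `⟨dn(v), dC(w)⟩ =
  -- 0`.
  have e' : (v.1 * w.2 - v.2 * w.1) * areaDensity n n p
      * det3 (ν p) (fderiv ℝ (fun q => f q + ρ q • ν q) p w) (n p)
      = ⟪fderiv ℝ ν p v, n p⟫ * secondForm (fun q => f q + ρ q • ν q) n p w w := by
    rw [secondForm]
    unfold areaDensity pdU pdV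
    linarith
  constructor
  · intro h0
    rw [h0, mul_zero, zero_mul] at e'
    exact (mul_eq_zero.1 e'.symm).resolve_left hN
  · intro h0
    rw [h0, mul_zero] at e'
    exact (mul_eq_zero.1 ((mul_eq_zero.1 e').resolve_right hd)).resolve_left hcoef

end IsFrontal

/-! ### Singular points of the second kind -/

/-- The kernel of a nonzero linear map on the plane is at most a line. -/
theorem exists_eq_smul_of_mem_ker {A : ℝ × ℝ →L[ℝ] E3} {v e w : ℝ × ℝ} (hv : A v = 0)
    (he : A e = 0) (he0 : e ≠ 0) (hw : A w ≠ 0) : ∃ c : ℝ, v = c • e := by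
  have h1 : (v.1 * e.2 - v.2 * e.1) • w
      = (w.1 * e.2 - w.2 * e.1) • v + (v.1 * w.2 - v.2 * w.1) • e := by
    ext
    · simp only [Prod.smul_fst, Prod.fst_add, smul_eq_mul]; ring
    · simp only [Prod.smul_snd, Prod.snd_add, smul_eq_mul]; ring
  have h2 := congrArg A h1
  rw [map_add, map_smul, map_smul, map_smul, hv, he, smul_zero, smul_zero, add_zero,
    smul_eq_zero] at h2
  have h3 := h2.resolve_right hw
  by_cases h0 : e.1 = 0
  · have h4 : e.2 ≠ 0 := fun h => he0 (Prod.ext h0 h)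
    have h5 : v.1 = 0 := by simpa [h0, h4] using h3
    refine ⟨v.2 / e.2, Prod.ext ?_ ?_⟩
    · simp [h5, h0]
    · simp [h4]
  · refine ⟨v.1 / e.1, Prod.ext ?_ ?_⟩
    · simp [h0]
    · simp only [Prod.smul_snd, smul_eq_mul]
      field_simp
      linarith

theorem det3_clm_mixed (A B : ℝ × ℝ →L[ℝ] E3) (X Y : ℝ × ℝ) (n : E3) :
    det3 (A X) (B Y) n + det3 (B X) (A Y) n = (X.1 * Y.2 - X.2 * Y.1) *
      (det3 (A (1, 0)) (B (0, 1)) n + det3 (B (1, 0)) (A (0, 1)) n) := by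
  rw [clm_prod_apply A X, clm_prod_apply A Y, clm_prod_apply B X, clm_prod_apply B Y]
  simp only [det3_eq, PiLp.add_apply, PiLp.smul_apply, smul_eq_mul]
  ring

/-- In the frame `(w, e)` only `det(dg(w), dn(e), n)` survives, as `dg(e) = 0`. The vectors `dg(w)`
and `dn(e)` are orthogonal by symmetry of the second fundamental form, and nonzero, the latter
because `g` is a front. -/
theorem IsFront.mixedDensity_ne_zero {S : Set (ℝ × ℝ)} {g n : ℝ × ℝ → E3} (h : IsFront S g n)
    (hS : IsOpen S) {p e w : ℝ × ℝ} (hp : p ∈ S) (he : e ≠ 0) (hge : fderiv ℝ g p e = 0)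
    (hw : fderiv ℝ g p w ≠ 0) : mixedDensity g n p ≠ 0 := by
  intro h0
  have hne : fderiv ℝ n p e ≠ 0 := fun hz => he (h.immersion p hp e hge hz)
  have h1 := det3_clm_mixed (fderiv ℝ g p) (fderiv ℝ n p) w e (n p)
  have h2 : det3 (fderiv ℝ g p (1, 0)) (fderiv ℝ n p (0, 1)) (n p)
      + det3 (fderiv ℝ n p (1, 0)) (fderiv ℝ g p (0, 1)) (n p) = 0 := neg_eq_zero.1 h0
  have h3 : det3 (fderiv ℝ n p w) 0 (n p) = 0 := by simp [det3_eq]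
  rw [h2, hge, h3, mul_zero, add_zero] at h1
  have h4 := det3_mul_det3 (z := fderiv ℝ g p w) (t := fderiv ℝ n p e) (h.norm_eq_one p hp)
    (h.orthogonal p hp w) (h.toIsFrontal.inner_fderiv hS hp e)
  rw [h1, h.toIsFrontal.inner_fderiv_comm hS hp, hge, inner_zero_left, zero_mul, zero_mul,
    sub_zero] at h4
  rcases mul_eq_zero.1 h4.symm with h5 | h5
  · exact hw (inner_self_eq_zero.1 h5)
  · exact hne (inner_self_eq_zero.1 h5)

theorem hasFDerivAt_mul_of_eq_zero {a b : ℝ × ℝ → ℝ} {p : ℝ × ℝ} (ha : DifferentiableAt ℝ a p)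
    (hb : DifferentiableAt ℝ b p) (ha0 : a p = 0) (hb0 : b p = 0) :
    HasFDerivAt (fun q => a q * b q) (0 : ℝ × ℝ →L[ℝ] ℝ) p := by
  have h := ha.hasFDerivAt.fun_mul hb.hasFDerivAt
  rw [ha0, hb0, zero_smul, zero_smul, add_zero] at h
  exact h

/-- A singular point of corank two is degenerate. -/
theorem fderiv_areaDensity_eq_zero {S : Set (ℝ × ℝ)} {g n : ℝ × ℝ → E3} {p : ℝ × ℝ}
    (hS : IsOpen S) (hp : p ∈ S) (hg : ContDiffOn ℝ ∞ g S) (hn : ContDiffOn ℝ ∞ n S)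
    (h0 : ∀ w, fderiv ℝ g p w = 0) : fderiv ℝ (areaDensity g n) p = 0 := by
  have hd : ∀ {a : ℝ × ℝ → E3}, ContDiffOn ℝ ∞ a S → ∀ i, DifferentiableAt ℝ (fun q => a q i) p :=
    fun ha i => (contDiffOn_euclidean.1 ha i).differentiableAt_of_isOpen hS hp
  have hu : ∀ i, DifferentiableAt ℝ (fun q => pdU g q i) p := hd (hg.fderiv_apply_const hS _)
  have hv : ∀ i, DifferentiableAt ℝ (fun q => pdV g q i) p := hd (hg.fderiv_apply_const hS _)
  have hu0 : pdU g p = 0 := h0 _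
  have hv0 : pdV g p = 0 := h0 _
  have key : ∀ i j k, HasFDerivAt
      (fun q => pdU g q i * (pdV g q j * n q k - pdV g q k * n q j)) (0 : ℝ × ℝ →L[ℝ] ℝ) p :=
    fun i j k => hasFDerivAt_mul_of_eq_zero (hu i)
      (((hv j).mul (hd hn k)).sub ((hv k).mul (hd hn j))) (by simp [hu0]) (by simp [hv0])
  have hsum := ((key 0 1 2).add (key 1 2 0)).add (key 2 0 1)
  rw [add_zero, add_zero] at hsum
  have he : areaDensity g n = _ := funext fun q => det3_eq (pdU g q) (pdV g q) (n q)
  rw [he]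
  exact hsum.fderiv

/-- At a singular point of the second kind, `dλ` vanishes in the null direction. -/
theorem IsSecondKind.exists_null {S : Set (ℝ × ℝ)} {g n : ℝ × ℝ → E3} {p : ℝ × ℝ}
    (h : IsSecondKind S g n p) (hS : IsOpen S) (hg : IsFrontal S g n) :
    ∃ e : ℝ × ℝ, e ≠ 0 ∧ fderiv ℝ g p e = 0 ∧ fderiv ℝ (areaDensity g n) p e = 0 := by
  obtain ⟨⟨hsing, -⟩, ε, γ, U, η, hγ, hη, hdep⟩ := h
  refine ⟨η p, hη.ne_zero p hη.mem, hη.null p ⟨hsing, hη.mem⟩, ?_⟩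
  have h0 : (0 : ℝ) ∈ Ioo (-ε) ε := ⟨neg_lt_zero.2 hγ.pos, hγ.pos⟩
  have hγd : HasDerivAt γ (deriv γ 0) 0 :=
    ((hγ.smooth.contDiffAt (isOpen_Ioo.mem_nhds h0)).differentiableAt (by simp)).hasDerivAt
  have hl : HasFDerivAt (areaDensity g n) (fderiv ℝ (areaDensity g n) p) (γ 0) := by
    rw [hγ.base]
    exact ((contDiffOn_areaDensity hS hg.smooth hg.smooth_normal).differentiableAt_of_isOpen hS
      hsing.1).hasFDerivAt
  have hcomp := hl.comp_hasDerivAt (0 : ℝ) hγd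
  have hz : HasDerivAt (areaDensity g n ∘ γ) 0 0 :=
    (hasDerivAt_const (0 : ℝ) (0 : ℝ)).congr_of_eventuallyEq
      (Filter.eventually_of_mem (isOpen_Ioo.mem_nhds h0) fun t ht => hγ.vanish t ht)
  have hγ0 := hcomp.unique hz
  rw [LinearIndependent.pair_iff] at hdep
  push Not at hdep
  obtain ⟨s, t, hst, hne⟩ := hdep
  -- The curve is regular, so a dependence relation must involve the null vector; `dλ(γ'(0)) = 0`
  -- then transfers to it.
  have ht : t ≠ 0 := fun ht => by
    rw [ht, zero_smul, add_zero, smul_eq_zero] at hst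
    exact hne (hst.resolve_right (hγ.regular 0 h0)) ht
  have h1 := congrArg (fderiv ℝ (areaDensity g n) p) hst
  rw [map_add, map_smul, map_smul, hγ0, smul_zero, zero_add, map_zero, smul_eq_zero] at h1
  exact h1.resolve_left ht

theorem fderiv_eq_of_eqOn {F : Type*} [NormedAddCommGroup F] [NormedSpace ℝ F]
    {U : Set (ℝ × ℝ)} {g g' : ℝ × ℝ → F} (hU : IsOpen U) (h : ∀ q ∈ U, g' q = g q) {q : ℝ × ℝ}
    (hq : q ∈ U) : fderiv ℝ g' q = fderiv ℝ g q :=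
  Filter.EventuallyEq.fderiv_eq (Filter.eventually_of_mem (hU.mem_nhds hq) h)

theorem IsFrontal.congr {U : Set (ℝ × ℝ)} {g g' n : ℝ × ℝ → E3} (h : IsFrontal U g n)
    (hU : IsOpen U) (he : ∀ q ∈ U, g' q = g q) : IsFrontal U g' n :=
  ⟨h.smooth.congr he, h.smooth_normal, h.norm_eq_one, fun q hq X => by
    rw [fderiv_eq_of_eqOn hU he hq]
    exact h.orthogonal q hq X⟩

/-- Smooth data describing the principal curvatures, the unbounded principal direction field `V`
and the focal surface near a singular point of the second kind. -/
theorem IsFront.exists_focalData {S : Set (ℝ × ℝ)} {f ν : ℝ × ℝ → E3} {p : ℝ × ℝ}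
    (hf : IsFront S f ν) (hS : IsOpen S) (hp : IsSecondKind S f ν p) :
    ∃ (U : Set (ℝ × ℝ)) (ρ κ : ℝ × ℝ → ℝ) (V : ℝ × ℝ → ℝ × ℝ) (w : ℝ × ℝ),
      IsOpen U ∧ p ∈ U ∧ U ⊆ S ∧ ContDiffOn ℝ ∞ ρ U ∧ ContDiffOn ℝ ∞ κ U ∧ ContDiffOn ℝ ∞ V U ∧
      (∀ q ∈ U, fderiv ℝ f q (V q) + ρ q • fderiv ℝ ν q (V q) = 0) ∧
      (∀ q ∈ U, det3 (pdU ν q + κ q • pdU f q) (pdV ν q + κ q • pdV f q) (ν q) = 0) ∧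
      ρ p = 0 ∧ fderiv ℝ ρ p (V p) = 0 ∧ fderiv ℝ ν p (V p) ≠ 0 ∧ fderiv ℝ f p w ≠ 0 ∧
      (∀ q ∈ U, focalSurface S f ν p q = f q + ρ q • ν q) ∧
      (IsSubparabolic S f ν p ↔ fderiv ℝ κ p (V p) = 0) := by
  have hfr := hf.toIsFrontal
  obtain ⟨e, he0, hfe, hle⟩ := hp.exists_null hS hfr
  obtain ⟨⟨hsing, hnd⟩, -⟩ := hp
  obtain ⟨hpS, hl0⟩ := hfr.mem_singularSet_iff.1 hsing
  have hd := fderiv_ne_zero_of_pd_ne_zero hnd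
  obtain ⟨w, hw⟩ : ∃ w, fderiv ℝ f p w ≠ 0 := by
    by_contra! hcon
    exact hd (fderiv_areaDensity_eq_zero hS hpS hf.smooth hf.smooth_normal hcon)
  obtain ⟨U, k, hU, hpU, hUS, hk, hk0, hquad, hkh, hbd, hub⟩ := hfr.exists_principalCurvatures hS
    hpS hl0 hd (hf.mixedDensity_ne_zero hS hpS he0 hfe hw)
  have hl := contDiffOn_areaDensity hS hf.smooth hf.smooth_normal
  have hm := contDiffOn_areaDensity hS hf.smooth_normal hf.smooth_normal
  set ρ : ℝ × ℝ → ℝ := fun q => areaDensity f ν q / k q with hρdef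
  set κ : ℝ × ℝ → ℝ := fun q => areaDensity ν ν q / k q with hκdef
  have hρ : ContDiffOn ℝ ∞ ρ U := (hl.mono hUS).div hk hk0
  have hκ : ContDiffOn ℝ ∞ κ U := (hm.mono hUS).div hk hk0
  have hρp : ρ p = 0 := by simp [hρdef, hl0]
  have hdetρ : ∀ q ∈ U, det3 (pdU f q + ρ q • pdU ν q) (pdV f q + ρ q • pdV ν q) (ν q) = 0 := by
    intro q hq
    have h1 := hquad q hq
    have h2 := hk0 q hq
    rw [det3_pencil]
    change areaDensity f ν q + _ * _ + _ * areaDensity ν ν q = 0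
    rw [← neg_neg (det3 _ _ _ + _)]
    change areaDensity f ν q + areaDensity f ν q / k q * -mixedDensity f ν q
      + (areaDensity f ν q / k q) ^ 2 * areaDensity ν ν q = 0
    field_simp
    linear_combination areaDensity f ν q * h1
  have hdetκ : ∀ q ∈ U, det3 (pdU ν q + κ q • pdU f q) (pdV ν q + κ q • pdV f q) (ν q) = 0 := by
    intro q hq
    have h1 := hquad q hq
    have h2 := hk0 q hq
    rw [det3_pencil, add_comm (det3 (pdU ν q) (pdV f q) (ν q))]
    change areaDensity ν ν q + _ * _ + _ * areaDensity f ν q = 0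
    rw [← neg_neg (det3 _ _ _ + _)]
    change areaDensity ν ν q + areaDensity ν ν q / k q * -mixedDensity f ν q
      + (areaDensity ν ν q / k q) ^ 2 * areaDensity f ν q = 0
    field_simp
    linear_combination areaDensity ν ν q * h1
  obtain ⟨O, V, hO, hpO, hOU, hV, hVO⟩ :=
    (hfr.mono hUS).exists_kernelField hU hpU hρ hρp hdetρ hw
  have hkerp : fderiv ℝ f p (V p) = 0 := by
    have := (hVO p hpO).2
    rwa [hρp, zero_smul, add_zero] at this
  have hVp0 := (hVO p hpO).1
  refine ⟨O, ρ, κ, V, w, hO, hpO, hOU.trans hUS, hρ.mono hOU, hκ.mono hOU, hV,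
    fun q hq => (hVO q hq).2, fun q hq => hdetκ q (hOU hq), hρp, ?_,
    fun hz => hVp0 (hf.immersion p hpS _ hkerp hz), hw, fun q hq => ?_, ?_⟩
  -- `V(p)` is a multiple of the null vector `e`, on which `dλ` vanishes. Since `λ(p) = 0`, `dρ = dλ
  -- / k` at `p`.
  · obtain ⟨c, hc⟩ := exists_eq_smul_of_mem_ker hkerp hfe he0 hw
    have h1 := fderiv_smul_apply_real (g := fun q => (k q)⁻¹)
      (hl.differentiableAt_of_isOpen hS hpS)
      ((hk.inv hk0).differentiableAt_of_isOpen hU hpU) (V p)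
    have hlV : fderiv ℝ (areaDensity f ν) p (V p) = 0 := by rw [hc, map_smul, hle, smul_zero]
    rw [hl0, zero_smul, zero_add, hlV, zero_smul] at h1
    exact h1
  · rw [focalSurface, rhoHat, hkh q (hOU hq)]
  · have hbp : fderiv ℝ (boundedPrincipal S f ν p) p = fderiv ℝ κ p :=
      fderiv_eq_of_eqOn hU hbd hpU
    constructor
    · rintro ⟨U₂, V₂, hU₂, hpU₂, hU₂S, hV₂, hder⟩
      rw [hbp] at hder
      -- Multiplied by `λ`, the equation of a principal vector of `κ̃` extends continuously to `p`,
      -- where it reads `k I(V₂, V₂) = 0`. So any such `V₂` is null at `p`, and sub-parabolicity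
      -- does not depend on its choice.
      have hcont : ContinuousOn (fun q => areaDensity f ν q * -⟪fderiv ℝ f q (V₂ p),
          fderiv ℝ ν q (V₂ q)⟫ - k q * ⟪fderiv ℝ f q (V₂ p), fderiv ℝ f q (V₂ q)⟫) (U ∩ U₂) := by
        have hUU : U ∩ U₂ ⊆ S := fun q hq => hUS hq.1
        have hV₂s : ContDiffOn ℝ ∞ V₂ (U ∩ U₂) := hV₂.smooth.mono inter_subset_right
        have h1 := (hf.smooth.fderiv_apply_const hS (V₂ p)).mono hUU
        have h2 := ((hf.smooth_normal.fderiv_of_isOpen hS (m := ∞) (by simp)).mono hUU).clm_apply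
          hV₂s
        have h3 := ((hf.smooth.fderiv_of_isOpen hS (m := ∞) (by simp)).mono hUU).clm_apply hV₂s
        exact (((hl.mono hUU).mul (h1.inner ℝ h2).neg).sub
          ((hk.mono inter_subset_left).mul (h1.inner ℝ h3))).continuousOn
      have hzero := eq_zero_of_frequently_ne_zero (hU.inter hU₂) ⟨hpU, hpU₂⟩
        (hl.eventually_frequently_ne_zero hS hpS hd).self_of_nhds hcont fun x hx hlx => by
          have h1 := hV₂.principal x ⟨hfr.mem_regularSet_iff.2 ⟨hUS hx.1, hlx⟩, hx.2⟩ (V₂ p)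
          rw [hub x hx.1 hlx, secondForm, firstForm] at h1
          field_simp at h1
          linarith
      simp only [hl0, zero_mul, zero_sub, neg_eq_zero] at hzero
      have hker₂ : fderiv ℝ f p (V₂ p) = 0 :=
        inner_self_eq_zero.1 ((mul_eq_zero.1 hzero).resolve_left (hk0 p hpU))
      obtain ⟨c, hc⟩ := exists_eq_smul_of_mem_ker hkerp hker₂ (hV₂.ne_zero p hpU₂) hw
      rw [hc, map_smul, hder, smul_zero]
    · intro hder
      refine ⟨O, V, hO, hpO, hOU.trans hUS, ⟨hV, fun q hq => (hVO q hq).1, fun q hq X => ?_⟩, by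
        rw [hbp, hder]⟩
      have hlq := (hfr.mem_regularSet_iff.1 hq.1).2
      have hkq := hk0 q (hOU hq.2)
      -- The relation `df(V) = -ρ dν(V)` with `ρ = λ/k = 1/κ̃` says that `V` is principal for `κ̃`.
      rw [hub q (hOU hq.2) hlq, secondForm, firstForm,
        eq_neg_of_add_eq_zero_left (hVO q hq.2).2, inner_neg_right, real_inner_smul_right]
      simp only [hρdef]
      field_simp
      ring

/-! ### The curvature of the focal surface at a point of the second kind -/

theorem theorem4p14 (S : Set (ℝ × ℝ)) (hS : IsOpen S) (f ν : ℝ × ℝ → E3) (hf : IsFront S f ν)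
    (p : ℝ × ℝ) (hp : IsSecondKind S f ν p) :
    (∃ (U : Set (ℝ × ℝ)) (n : ℝ × ℝ → E3), IsOpen U ∧ p ∈ U ∧ U ⊆ S ∧
      IsFrontal U (focalSurface S f ν p) n) ∧
    ∀ (U : Set (ℝ × ℝ)) (n : ℝ × ℝ → E3), IsOpen U → p ∈ U → U ⊆ S →
      IsFrontal U (focalSurface S f ν p) n →
      IsNondegenerateSingular U (focalSurface S f ν p) n p →
      (RationallyBoundedAt (regularSet U (focalSurface S f ν p))
          (gaussianCurvature (focalSurface S f ν p) n) p ↔ IsSubparabolic S f ν p) ∧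
      (IsSubparabolic S f ν p ↔ HasLimitingNormalCurvature (focalSurface S f ν p) n p 0) := by
  obtain ⟨O, ρ, κ, V, w, hO, hpO, hOS, hρ, hκ, hV, hker, hdet, hρp, hρV, hVp, hw, hfoc, hsub⟩ :=
    hf.exists_focalData hS hp
  have hfO : IsFrontal O f ν := hf.toIsFrontal.mono hOS
  refine ⟨?_, fun U n hU hpU hUS hn hnd => ?_⟩
  · obtain ⟨O', n, hO', hpO', hOO', hn⟩ := hfO.exists_focal_isFrontal hO hpO hρ hV hker hVp
    exact ⟨O', n, hO', hpO', hOO'.trans hOS, hn.congr hO' fun q hq => hfoc q (hOO' hq)⟩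
  have hI : IsOpen (O ∩ U) := hO.inter hU
  have hpI : p ∈ O ∩ U := ⟨hpO, hpU⟩
  have hsubO : O ∩ U ⊆ O := inter_subset_left
  have hnI : IsFrontal (O ∩ U) (fun q => f q + ρ q • ν q) n :=
    (hn.mono inter_subset_right).congr hI fun q hq => (hfoc q hq.1).symm
  have hfd : ∀ q ∈ O ∩ U, fderiv ℝ (focalSurface S f ν p) q =
      fderiv ℝ (fun q => f q + ρ q • ν q) q := fun q hq => fderiv_eq_of_eqOn hO hfoc hq.1
  have hnd0 := fderiv_ne_zero_of_pd_ne_zero hnd.2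
  have hnd' : fderiv ℝ (areaDensity (fun q => f q + ρ q • ν q) n) p ≠ 0 := by
    rw [← fderiv_eq_of_eqOn (g' := areaDensity (focalSurface S f ν p) n) hI (fun q hq => ?_) hpI]
    · exact hnd0
    · rw [areaDensity, areaDensity, pdU, pdV, hfd q hq, pdU, pdV]
  obtain ⟨hN, hnν, hII⟩ := (hfO.mono hsubO).secondForm_focal hI hpI (hρ.mono hsubO) (hκ.mono hsubO)
    (hV.mono hsubO) (fun q hq => hker q hq.1) (fun q hq => hdet q hq.1) hρp hρV hVp hnI hnd'
  have hkerp : fderiv ℝ f p (V p) = 0 := by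
    have := hker p hpO
    rwa [hρp, zero_smul, add_zero] at this
  have hform : ∀ X, secondForm (focalSurface S f ν p) n p X X =
      secondForm (fun q => f q + ρ q • ν q) n p X X := fun X => by
    rw [secondForm, hfd p hpI, secondForm]
  have hiff : secondForm (fun q => f q + ρ q • ν q) n p w w = 0 ↔ fderiv ℝ κ p (V p) = 0 := by
    have h1 := hII w
    constructor
    · intro h0
      rw [h0, mul_zero] at h1
      exact (mul_eq_zero.1 h1).resolve_right fun hz => hw (inner_self_eq_zero.1 hz)
    · intro h0
      rw [h0, zero_mul] at h1
      exact (mul_eq_zero.1 h1.symm).resolve_left hN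
  constructor
  · rw [rationallyBoundedAt_iff hU hpU
      (contDiffOn_areaDensity hU hn.smooth_normal hn.smooth_normal)
      (contDiffOn_areaDensity hU hn.smooth hn.smooth_normal) (fun q => hn.mem_regularSet_iff)
      (fun q hq => hn.gaussianCurvature_eq hU hq) (hn.mem_singularSet_iff.1 hnd.1).2 hnd0,
      (hfO.mono hsubO).areaDensity_normal_focal hI hpI (hρ.mono hsubO) hkerp hρp hρV hnI hN hnν hw,
      hiff, hsub]
  · rw [hsub]
    -- The tangential part of `dC(w)` at `p` is `df(w)`, so `w` is not null for the focal surface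
    -- either.
    have hCw : fderiv ℝ (focalSurface S f ν p) p w ≠ 0 := by
      intro h0
      rw [hfd p hpI, hfO.fderiv_focal hO hρ hpO, hρp, zero_smul, add_zero] at h0
      have h1 := congrArg (fun T => ⟪T, fderiv ℝ f p w⟫) h0
      simp only [inner_add_left, real_inner_smul_left, inner_zero_left,
        real_inner_comm (fderiv ℝ f p w) (ν p), hfO.orthogonal p hpO, mul_zero, add_zero] at h1
      exact hw (inner_self_eq_zero.1 h1)
    constructor
    · refine fun h0 => ⟨⟨w, hCw⟩, fun X _ => ?_⟩
      have h1 := hII X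
      rw [h0, zero_mul] at h1
      rw [hform, (mul_eq_zero.1 h1.symm).resolve_left hN, zero_div]
    · rintro ⟨-, hlim⟩
      rw [← hiff, ← hform]
      exact (div_eq_zero_iff.1 (hlim w hCw)).resolve_right fun hz =>
        hCw (inner_self_eq_zero.1 hz)
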